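/- Let $R$ be a principal ideal domain (fields are allowed), and write $\otimes=\otimes_R$. A submodule $N$ of an $R$-module $M$ is \emph{pure} if $N\otimes A\to M\otimes A$ is injective for every $R$-module $A$. Coalgebras over $R$ are coassociative and counital. A \emph{pure subcoalgebra} of a coalgebra $C$ is a pure submodule $D\subseteq C$ such that the comultiplication of $C$ maps $D$ into $D\otimes D\subseteq C\otimes C$; it is a coalgebra with the restricted structure maps. A coalgebra is \emph{pure simple} if it is nonzero and its only pure subcoalgebras are $0$ and itself, and a flat coalgebra is \emph{pointed} if each of its pure subcoalgebras that is pure simple is isomorphic, as a coalgebra, to $R$. Let $\mathcal{CA}^{flat}_*$ be the category of cocommutative pointed $R$-coalgebras whose underlying module is flat, with all coalgebra maps, and let $\mathbf{Mod}^{flat}$ be the category of flat $R$-modules and linear maps. \textbf{Theorem.} \begin{enumerate} \item The forgetful functor $U:\mathcal{CA}^{flat}_*\to\mathbf{Mod}^{flat}$ has a right adjoint, and it is comonadic: the comparison functor from $\mathcal{CA}^{flat}_*$ to the category of coalgebras of the induced comonad on $\mathbf{Mod}^{flat}$ is an equivalence. \item The category $\mathcal{CA}^{flat}_*$ is cartesian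 closed, with finite products given by the tensor product: the coalgebra $R$ belongs to $\mathcal{CA}^{flat}_*$ and is terminal there; for $C,D$ in $\mathcal{CA}^{flat}_*$ the tensor product coalgebra $C\otimes D$ belongs to $\mathcal{CA}^{flat}_*$ and, with the projections $\mathrm{id}_C\otimes\epsilon_D$ and $\epsilon_C\otimes\mathrm{id}_D$, is a product of $C$ and $D$ there; and every functor $C\otimes -:\mathcal{CA}^{flat}_*\to\mathcal{CA}^{flat}_*$ has a right adjoint. \end{enumerate} -/

import Mathlib

open CategoryTheory MonoidalCategory
open scoped TensorProduct

universe u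

section PureSubcoalgebras

variable (R : Type u) [CommRing R]

/-- A submodule `N` of `M` is pure if `N ⊗ A → M ⊗ A` is injective for every `R`-module `A`. -/
def IsPureSubmodule {M : Type u} [AddCommGroup M] [Module R M] (N : Submodule R M) : Prop :=
  ∀ (A : Type u) [AddCommGroup A] [Module R A], Function.Injective (N.subtype.rTensor A)

/-- A pure subcoalgebra of `C`: a pure submodule `D` such that the comultiplication of `C` sends
`D` into the image of `D ⊗ D` in `C ⊗ C` (by purity, `D ⊗ D → C ⊗ C` is injective). -/
structure PureSubcoalgebra (C : Type u) [AddCommGroup C] [Module R C] [Coalgebra R C] where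
  carrier : Submodule R C
  isPure : IsPureSubmodule R carrier
  comul_mem : ∀ x ∈ carrier, Coalgebra.comul (R := R) x ∈
    LinearMap.range (TensorProduct.map carrier.subtype carrier.subtype)

namespace PureSubcoalgebra

variable {R} {C : Type u} [AddCommGroup C] [Module R C] [Coalgebra R C]

lemma lTensor_injective (D : PureSubcoalgebra R C) (A : Type u) [AddCommGroup A] [Module R A] :
    Function.Injective (D.carrier.subtype.lTensor A) :=
  (LinearMap.lTensor_inj_iff_rTensor_inj A D.carrier.subtype).mpr (D.isPure A)

lemma map_injective (D : PureSubcoalgebra R C) :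
    Function.Injective (TensorProduct.map D.carrier.subtype D.carrier.subtype) := by
  rw [← LinearMap.rTensor_comp_lTensor]
  exact (D.isPure C).comp (D.lTensor_injective D.carrier)

lemma map_map_injective (D : PureSubcoalgebra R C) :
    Function.Injective (TensorProduct.map D.carrier.subtype
      (TensorProduct.map D.carrier.subtype D.carrier.subtype)) := by
  have e : TensorProduct.map D.carrier.subtype
      (TensorProduct.map D.carrier.subtype D.carrier.subtype) =
      D.carrier.subtype.rTensor (C ⊗[R] C) ∘ₗ
        (TensorProduct.leftComm R C D.carrier C).toLinearMap ∘ₗ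
          D.carrier.subtype.rTensor (D.carrier ⊗[R] C) ∘ₗ
            (TensorProduct.leftComm R D.carrier D.carrier C).toLinearMap ∘ₗ
              (TensorProduct.assoc R D.carrier D.carrier C).toLinearMap ∘ₗ
                D.carrier.subtype.lTensor (D.carrier ⊗[R] D.carrier) ∘ₗ
                  (TensorProduct.assoc R D.carrier D.carrier D.carrier).symm.toLinearMap := by
    ext; simp
  rw [e]
  simp only [LinearMap.coe_comp, LinearEquiv.coe_coe]
  exact (D.isPure _).comp <| (LinearEquiv.injective _).comp <| (D.isPure _).comp <|
    (LinearEquiv.injective _).comp <| (LinearEquiv.injective _).comp <|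
      (D.lTensor_injective _).comp (LinearEquiv.injective _)

/-- The restriction of the comultiplication of `C` to a pure subcoalgebra. -/
noncomputable def comul (D : PureSubcoalgebra R C) : D.carrier →ₗ[R] D.carrier ⊗[R] D.carrier :=
  (LinearEquiv.ofInjective _ D.map_injective).symm.toLinearMap ∘ₗ
    ((Coalgebra.comul (R := R) (A := C)).domRestrict D.carrier).codRestrict _
      (fun x => D.comul_mem x x.2)

lemma map_comul (D : PureSubcoalgebra R C) :
    TensorProduct.map D.carrier.subtype D.carrier.subtype ∘ₗ D.comul =
      Coalgebra.comul (R := R) (A := C) ∘ₗ D.carrier.subtype := by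
  ext x
  have := LinearEquiv.apply_symm_apply (LinearEquiv.ofInjective _ D.map_injective)
    (((Coalgebra.comul (R := R) (A := C)).domRestrict D.carrier).codRestrict _
      (fun x => D.comul_mem x x.2) x)
  exact congrArg Subtype.val this

/-- A pure subcoalgebra is a coalgebra, with the restricted comultiplication and counit. -/
noncomputable instance (D : PureSubcoalgebra R C) : Coalgebra R D.carrier where
  comul := D.comul
  counit := Coalgebra.counit ∘ₗ D.carrier.subtype
  coassoc := by
    have hl : TensorProduct.map D.carrier.subtype
        (TensorProduct.map D.carrier.subtype D.carrier.subtype) ∘ₗ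
          (TensorProduct.assoc R D.carrier D.carrier D.carrier).toLinearMap =
        (TensorProduct.assoc R C C C).toLinearMap ∘ₗ TensorProduct.map
          (TensorProduct.map D.carrier.subtype D.carrier.subtype) D.carrier.subtype := by
      ext; simp
    have h1 : TensorProduct.map (TensorProduct.map D.carrier.subtype D.carrier.subtype)
        D.carrier.subtype ∘ₗ D.comul.rTensor D.carrier =
        (Coalgebra.comul (R := R) (A := C)).rTensor C ∘ₗ
          TensorProduct.map D.carrier.subtype D.carrier.subtype := by
      rw [LinearMap.map_comp_rTensor, LinearMap.rTensor_comp_map, D.map_comul]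
    have h2 : TensorProduct.map D.carrier.subtype
        (TensorProduct.map D.carrier.subtype D.carrier.subtype) ∘ₗ D.comul.lTensor D.carrier =
        (Coalgebra.comul (R := R) (A := C)).lTensor C ∘ₗ
          TensorProduct.map D.carrier.subtype D.carrier.subtype := by
      rw [LinearMap.map_comp_lTensor, LinearMap.lTensor_comp_map, D.map_comul]
    refine LinearMap.cancel_left D.map_map_injective |>.mp ?_
    calc _ = (_ ∘ₗ (TensorProduct.assoc R D.carrier D.carrier D.carrier).toLinearMap) ∘ₗ
            D.comul.rTensor D.carrier ∘ₗ D.comul := rfl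
      _ = (TensorProduct.assoc R C C C).toLinearMap ∘ₗ (TensorProduct.map
            (TensorProduct.map D.carrier.subtype D.carrier.subtype) D.carrier.subtype ∘ₗ
              D.comul.rTensor D.carrier) ∘ₗ D.comul := by rw [hl]; rfl
      _ = ((TensorProduct.assoc R C C C).toLinearMap ∘ₗ
            (Coalgebra.comul (R := R) (A := C)).rTensor C) ∘ₗ
              TensorProduct.map D.carrier.subtype D.carrier.subtype ∘ₗ D.comul := by rw [h1]; rfl
      _ = ((TensorProduct.assoc R C C C).toLinearMap ∘ₗ
            (Coalgebra.comul (R := R) (A := C)).rTensor C ∘ₗ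
              Coalgebra.comul (R := R) (A := C)) ∘ₗ D.carrier.subtype := by
            rw [D.map_comul]; rfl
      _ = (Coalgebra.comul (R := R) (A := C)).lTensor C ∘ₗ
            Coalgebra.comul (R := R) (A := C) ∘ₗ D.carrier.subtype := by
            rw [Coalgebra.coassoc]; rfl
      _ = ((Coalgebra.comul (R := R) (A := C)).lTensor C ∘ₗ
            TensorProduct.map D.carrier.subtype D.carrier.subtype) ∘ₗ D.comul := by
            rw [← D.map_comul]; rfl
      _ = _ := by rw [← h2]
  rTensor_counit_comp_comul := by
    refine LinearMap.cancel_left (D.lTensor_injective R) |>.mp ?_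
    calc _ = (Coalgebra.counit (R := R) (A := C)).rTensor C ∘ₗ
            TensorProduct.map D.carrier.subtype D.carrier.subtype ∘ₗ D.comul := by
            rw [← LinearMap.comp_assoc, ← LinearMap.comp_assoc, LinearMap.rTensor_comp_map,
              LinearMap.lTensor_comp_rTensor]
      _ = ((Coalgebra.counit (R := R) (A := C)).rTensor C ∘ₗ
            Coalgebra.comul (R := R) (A := C)) ∘ₗ D.carrier.subtype := by
            rw [D.map_comul]; rfl
      _ = _ := by rw [Coalgebra.rTensor_counit_comp_comul]; ext; simp
  lTensor_counit_comp_comul := by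
    refine LinearMap.cancel_left (D.isPure R) |>.mp ?_
    calc _ = (Coalgebra.counit (R := R) (A := C)).lTensor C ∘ₗ
            TensorProduct.map D.carrier.subtype D.carrier.subtype ∘ₗ D.comul := by
            rw [← LinearMap.comp_assoc, ← LinearMap.comp_assoc, LinearMap.lTensor_comp_map,
              LinearMap.rTensor_comp_lTensor]
      _ = ((Coalgebra.counit (R := R) (A := C)).lTensor C ∘ₗ
            Coalgebra.comul (R := R) (A := C)) ∘ₗ D.carrier.subtype := by
            rw [D.map_comul]; rfl
      _ = _ := by rw [Coalgebra.lTensor_counit_comp_comul]; ext; simp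

end PureSubcoalgebra

/-- A nonzero coalgebra is pure simple if its only pure subcoalgebras are `0` and itself. -/
def IsPureSimple (C : Type u) [AddCommGroup C] [Module R C] [Coalgebra R C] : Prop :=
  Nontrivial C ∧ ∀ D : PureSubcoalgebra R C, D.carrier = ⊥ ∨ D.carrier = ⊤

/-- A coalgebra is pointed if each of its pure simple (pure) subcoalgebras is isomorphic, as a
coalgebra, to the ground ring. -/
def IsPointedCoalgebra (C : Type u) [AddCommGroup C] [Module R C] [Coalgebra R C] : Prop :=
  ∀ D : PureSubcoalgebra R C, IsPureSimple R D.carrier → Nonempty (D.carrier ≃ₗc[R] R)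

end PureSubcoalgebras

section Categories

variable (R : Type u) [CommRing R]

/-- Flatness, as a property of objects of the category of `R`-modules. -/
def flatModules : ObjectProperty (ModuleCat.{u} R) := fun M => Module.Flat R M

/-- The category of flat `R`-modules and all linear maps between them. -/
abbrev FlatMod : Type (u + 1) := (flatModules R).FullSubcategory

/-- The property of a (coassociative, counital) coalgebra of being cocommutative, flat as an
`R`-module, and pointed. -/
def flatPointedCocommutative : ObjectProperty (CoalgCat.{u} R) := fun C =>
  Coalgebra.IsCocomm R C ∧ Module.Flat R C ∧ IsPointedCoalgebra R C

/-- The category of flat pointed cocommutative `R`-coalgebras and all coalgebra maps. -/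
abbrev FlatPointedCoalg : Type (u + 1) := (flatPointedCocommutative R).FullSubcategory

/-- The functor that sends a flat pointed cocommutative coalgebra to its underlying module. -/
def forgetToFlatMod : FlatPointedCoalg R ⥤ FlatMod R :=
  (flatModules R).lift
    ((flatPointedCocommutative R).ι ⋙ forget₂ (CoalgCat.{u} R) (ModuleCat.{u} R))
    (fun C => C.property.2.1)

end Categories

/-! Let `K` be the fraction field. A functional `φ : C → K` gives the operator `act φ : c ↦ ∑ φ(c₁)
⊗ c₂` on `K ⊗ C`. By coassociativity and cocommutativity these operators commute, and the subspaces
stable under all of them encode the pure subcoalgebras: `X` gives `K ⊗ X`, and `V` gives back `{x |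
1 ⊗ x ∈ V}`. Every vector lies in a finite-dimensional stable subspace.

The key is a linear criterion: `C` is pointed if and only if, for every `φ`, each vector of `K ⊗ C`
is killed by a nonzero split polynomial in `act φ` (`IsPointedCoalgebra.splitSubmodule_act`,
`isPointedCoalgebra_of_splitSubmodule_act`). If `C` is pointed, a minimal stable subspace of the
kernel of an irreducible polynomial in `act φ` contains a common eigenvector, so that polynomial is
linear. Conversely, by Schur's lemma `act φ` is a scalar on a pure simple subcoalgebra; hence the
counit is injective there, and its image, a nonzero idempotent ideal of a domain, is `R`. The
criterion makes pointedness pass to coalgebras that inject into a pointed one and to jointly epic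
targets; the same Schur argument handles tensor products.

Hence the forgetful functor creates colimits. Coalgebras carried by submodules of `Kⁿ` form a
separating set, and quotients of an object form a set, so the special adjoint functor theorem gives
a right adjoint to every colimit-preserving functor: to the forgetful functor, and to `C ⊗ -`, which
preserves colimits because it does so on flat modules. Comonadicity is Beck's theorem: for a pair
that splits on modules, the kernel of the difference is a pure subcoalgebra. That `⊗` is the product
is the usual fact for cocommutative coalgebras. -/

set_option linter.unusedSectionVars false

/-! ### Purity over a principal ideal domain. -/

section Purity

variable {R : Type u} [CommRing R]

lemma isPureSubmodule_of_flat_quotient {M : Type u} [AddCommGroup M] [Module R M]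
    (N : Submodule R M) [Module.Flat R (M ⧸ N)] : IsPureSubmodule R N := fun A _ _ =>
  (LinearMap.lTensor_inj_iff_rTensor_inj A N.subtype).mp <|
    LinearMap.lTensor_injective_of_exact_of_flat N.mkQ N.mkQ_surjective N.subtype
      N.injective_subtype (LinearMap.exact_subtype_mkQ N) A

/-- Test purity against `R ⧸ (r)`: the tensor `(r • x) ⊗ 1` dies in `M ⊗ R ⧸ (r)`, hence already in
`N ⊗ R ⧸ (r)`, so `r • x ∈ r • N`, and `r` cancels. -/
lemma IsPureSubmodule.mem_of_smul_mem [IsDomain R] {M : Type u} [AddCommGroup M] [Module R M]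
    [Module.IsTorsionFree R M] {N : Submodule R M} (hN : IsPureSubmodule R N) {r : R}
    (hr : r ≠ 0) {x : M} (hx : r • x ∈ N) : x ∈ N := by
  have h0 : (⟨r • x, hx⟩ : N) ⊗ₜ[R] (1 : R ⧸ Ideal.span {r}) = 0 := by
    apply hN
    have : r • (1 : R ⧸ Ideal.span {r}) = 0 := by
      rw [Algebra.smul_def, mul_one, Ideal.Quotient.algebraMap_eq, Ideal.Quotient.eq_zero_iff_mem]
      exact Ideal.mem_span_singleton_self r
    simp [TensorProduct.smul_tmul, this]
  have h1 := congrArg (TensorProduct.tensorQuotEquivQuotSMul N (Ideal.span {r})) h0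
  rw [← map_one (Ideal.Quotient.mk _), TensorProduct.tensorQuotEquivQuotSMul_tmul_mk, map_zero,
    one_smul, Submodule.Quotient.mk_eq_zero, Submodule.ideal_span_singleton_smul,
    Submodule.mem_smul_pointwise_iff_exists] at h1
  obtain ⟨n, -, hn⟩ := h1
  have h2 : r • (n : M) = r • x := congrArg Subtype.val hn
  rw [← smul_right_injective M hr h2]
  exact n.2

/-- The quotient embeds in the torsion-free module `W`, and torsion-free modules over a principal
ideal domain are flat. -/
lemma isPureSubmodule_ker [IsDomain R] [IsPrincipalIdealRing R] {M W : Type u} [AddCommGroup M]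
    [Module R M] [AddCommGroup W] [Module R W] [Module.IsTorsionFree R W] (T : M →ₗ[R] W) :
    IsPureSubmodule R (LinearMap.ker T) := by
  have : Module.IsTorsionFree R (M ⧸ LinearMap.ker T) :=
    Function.Injective.moduleIsTorsionFree _
      (LinearMap.ker_eq_bot.mp (Submodule.ker_liftQ_eq_bot' _ T rfl)) fun r x => map_smul _ r x
  exact isPureSubmodule_of_flat_quotient _

/-- Flatness is used twice: `h₁` moves `y` into `ker T ⊗ M`, and since `ker T ⊗ W → M ⊗ W` is
injective, `h₂` then moves it into `ker T ⊗ ker T`. -/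
lemma mem_range_map_subtype_of_mem_ker {M W : Type u} [AddCommGroup M] [Module R M]
    [Module.Flat R M] [AddCommGroup W] [Module R W] [Module.Flat R W] (T : M →ₗ[R] W)
    [Module.Flat R (LinearMap.ker T)] {y : M ⊗[R] M} (h₁ : T.rTensor M y = 0)
    (h₂ : T.lTensor M y = 0) :
    y ∈ LinearMap.range (TensorProduct.map (LinearMap.ker T).subtype (LinearMap.ker T).subtype) := by
  obtain ⟨z, rfl⟩ := (Module.Flat.rTensor_exact M (LinearMap.exact_subtype_ker_map T) y).mp h₁
  have hz : T.lTensor (LinearMap.ker T) z = 0 := by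
    apply Module.Flat.rTensor_preserves_injective_linearMap (M := W) (LinearMap.ker T).subtype
      (LinearMap.ker T).injective_subtype
    rw [map_zero, ← h₂, ← LinearMap.comp_apply, ← LinearMap.comp_apply,
      LinearMap.rTensor_comp_lTensor, LinearMap.lTensor_comp_rTensor]
  obtain ⟨w, rfl⟩ :=
    (Module.Flat.lTensor_exact (LinearMap.ker T) (LinearMap.exact_subtype_ker_map T) z).mp hz
  exact ⟨w, by rw [← LinearMap.rTensor_comp_lTensor]; rfl⟩

end Purity

/-! ### Passage to the fraction field. -/

section Localization

variable {R : Type u} [CommRing R] (K : Type u) [Field K] [Algebra R K]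
  [IsFractionRing R K]

lemma isTorsionFree_of_module_fractionRing [IsDomain R] (W : Type*) [AddCommGroup W] [Module R W] [Module K W]
    [IsScalarTower R K W] : Module.IsTorsionFree R W :=
  .of_smul_eq_zero fun r x h => by
    rw [← algebraMap_smul K r x, smul_eq_zero] at h
    exact h.imp_left fun h => by simpa using h

variable {M : Type u} [AddCommGroup M] [Module R M]

lemma tmul_one_injective [Module.Flat R M] :
    Function.Injective (TensorProduct.mk R K M 1) := by
  have h := Module.Flat.rTensor_preserves_injective_linearMap (M := M) (Algebra.linearMap R K)
    (IsFractionRing.injective R K)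
  convert h.comp (TensorProduct.lid R M).symm.injective
  ext; simp

variable {K} in
/-- Every element of `K ⊗ M` is a fraction. -/
lemma exists_smul_eq_one_tmul [IsDomain R] (x : K ⊗[R] M) :
    ∃ (r : R) (m : M), r ≠ 0 ∧ r • x = 1 ⊗ₜ m := by
  have := (isLocalizedModule_iff_isBaseChange (nonZeroDivisors R) K
    (TensorProduct.mk R K M 1)).mpr (TensorProduct.isBaseChange R M K)
  obtain ⟨⟨m, r⟩, h⟩ := IsLocalizedModule.surj (nonZeroDivisors R) (TensorProduct.mk R K M 1) x
  exact ⟨r, m, nonZeroDivisors.ne_zero r.2, h⟩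

/-- A pure submodule is saturated, so it is recovered from its span over `K`; denominators are
cleared and then cancelled. -/
lemma IsPureSubmodule.one_tmul_mem_baseChange [IsDomain R] [Module.Flat R M]
    {N : Submodule R M} (hN : IsPureSubmodule R N) {x : M} (hx : (1 : K) ⊗ₜ[R] x ∈ N.baseChange K) :
    x ∈ N := by
  obtain ⟨y, hy⟩ := hx
  obtain ⟨r, n, hr, hn⟩ := exists_smul_eq_one_tmul y
  refine hN.mem_of_smul_mem hr (x := x) ?_
  have : TensorProduct.mk R K M 1 (r • x) = TensorProduct.mk R K M 1 (n : M) := by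
    have := congrArg (N.subtype.baseChange K) hn
    simp only [TensorProduct.mk_apply, LinearMap.baseChange_tmul, Submodule.subtype_apply] at this ⊢
    rw [← this, TensorProduct.tmul_smul, ← hy]
    exact (((N.subtype.baseChange K).restrictScalars R).map_smul r y).symm
  rw [tmul_one_injective K this]
  exact n.2

end Localization

/-! ### The operators attached to functionals on a coalgebra. -/

section Action

open Coalgebra

variable {R : Type u} [CommRing R] {K : Type u} [Field K] [Algebra R K]
  {C D : Type u} [AddCommGroup C] [Module R C] [Coalgebra R C]
  [AddCommGroup D] [Module R D] [Coalgebra R D]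

/-- The operator `c ↦ ∑ φ(c₁) ⊗ c₂` on `K ⊗ C` attached to a `K`-valued functional `φ` on `C`. -/
noncomputable def act (φ : C →ₗ[R] K) : Module.End K (K ⊗[R] C) :=
  (φ.rTensor C ∘ₗ comul).liftBaseChange K

lemma act_one_tmul (φ : C →ₗ[R] K) (x : C) : act φ (1 ⊗ₜ x) = φ.rTensor C (comul x) := by
  simp [act]

/-- The convolution product of two functionals. -/
noncomputable def convFun (φ ψ : C →ₗ[R] K) : C →ₗ[R] K :=
  LinearMap.mul' R K ∘ₗ TensorProduct.map φ ψ ∘ₗ comul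

/-- The counit, as a functional with values in `K`. -/
noncomputable def counitFun : C →ₗ[R] K := Algebra.linearMap R K ∘ₗ counit

/-- Coassociativity: both sides send `x` to `∑ φ(x₁) ψ(x₂) ⊗ x₃`, the value of `F` on the iterated
comultiplication. -/
lemma act_comp_act (φ ψ : C →ₗ[R] K) : act ψ ∘ₗ act φ = act (convFun φ ψ) := by
  ext x
  simp only [TensorProduct.AlgebraTensorModule.curry_apply,
    TensorProduct.curry_apply, LinearMap.coe_restrictScalars, LinearMap.comp_apply, act_one_tmul]
  let F : C ⊗[R] (C ⊗[R] C) →ₗ[R] K ⊗[R] C :=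
    TensorProduct.lift ((LinearMap.lsmul K (K ⊗[R] C)).restrictScalars₁₂ R R ∘ₗ φ) ∘ₗ
      (ψ.rTensor C).lTensor C
  have hF (a b c : C) : F (a ⊗ₜ (b ⊗ₜ c)) = φ a • (ψ b ⊗ₜ c) := by simp [F]
  have h1 : (act ψ).restrictScalars R ∘ₗ φ.rTensor C = F ∘ₗ comul.lTensor C := by
    ext a b
    simp only [TensorProduct.AlgebraTensorModule.curry_apply, LinearMap.restrictScalars_self,
      TensorProduct.curry_apply, LinearMap.coe_restrictScalars, LinearMap.comp_apply,
      LinearMap.rTensor_tmul, LinearMap.lTensor_tmul]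
    rw [← mul_one (φ a), ← smul_eq_mul, ← TensorProduct.smul_tmul', map_smul, act_one_tmul]
    simp [F]
  have h2 : (convFun φ ψ).rTensor C = F ∘ₗ (TensorProduct.assoc R C C C).toLinearMap ∘ₗ
      comul.rTensor C := by
    have h3 : (LinearMap.mul' R K ∘ₗ TensorProduct.map φ ψ).rTensor C =
        F ∘ₗ (TensorProduct.assoc R C C C).toLinearMap := by
      ext a b c
      simp [hF, TensorProduct.smul_tmul']
    rw [convFun, ← LinearMap.comp_assoc, LinearMap.rTensor_comp, h3, LinearMap.comp_assoc]
  have h := congrArg F (LinearMap.congr_fun (coassoc (R := R) (A := C)) x)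
  have e1 := LinearMap.congr_fun h1 (comul x)
  have e2 := LinearMap.congr_fun h2 (comul x)
  simp only [LinearMap.comp_apply, LinearMap.coe_restrictScalars, LinearEquiv.coe_coe] at h e1 e2
  rw [e1, e2, h]

lemma convFun_comm [IsCocomm R C] (φ ψ : C →ₗ[R] K) : convFun φ ψ = convFun ψ φ := by
  have : LinearMap.mul' R K ∘ₗ TensorProduct.map φ ψ =
      (LinearMap.mul' R K ∘ₗ TensorProduct.map ψ φ) ∘ₗ (TensorProduct.comm R C C).toLinearMap := by
    ext a b; simp [mul_comm]
  rw [convFun, ← LinearMap.comp_assoc, this, LinearMap.comp_assoc, IsCocomm.comm_comp_comul]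
  rfl

lemma act_commute [IsCocomm R C] (φ ψ : C →ₗ[R] K) : Commute (act φ) (act ψ) := by
  rw [Commute, SemiconjBy, Module.End.mul_eq_comp, Module.End.mul_eq_comp, act_comp_act,
    act_comp_act, convFun_comm]

lemma act_counitFun : act (counitFun (R := R) (K := K) (C := C)) = 1 := by
  ext x
  simp only [TensorProduct.AlgebraTensorModule.curry_apply,
    TensorProduct.curry_apply, LinearMap.coe_restrictScalars, act_one_tmul, counitFun]
  rw [LinearMap.rTensor_comp, LinearMap.comp_apply, rTensor_counit_comul]
  simp

/-- The counit recovers a functional from its operator. This later turns "`act φ` is a scalar" into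
"`φ` is a multiple of the counit". -/
lemma counitFun_act (φ : C →ₗ[R] K) :
    counitFun.liftBaseChange K ∘ₗ act φ = φ.liftBaseChange K := by
  ext x
  simp only [TensorProduct.AlgebraTensorModule.curry_apply,
    TensorProduct.curry_apply, LinearMap.coe_restrictScalars, LinearMap.comp_apply, act_one_tmul,
    LinearMap.liftBaseChange_tmul, one_smul]
  have : (counitFun.liftBaseChange K).restrictScalars R ∘ₗ φ.rTensor C =
      (TensorProduct.rid R K).toLinearMap ∘ₗ φ.rTensor R ∘ₗ counit.lTensor C := by
    ext a b
    simp [counitFun, Algebra.smul_def, mul_comm]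
  have := LinearMap.congr_fun this (comul x)
  simp only [LinearMap.comp_apply, LinearMap.coe_restrictScalars, LinearEquiv.coe_coe,
    lTensor_counit_comul] at this
  rw [this]
  simp

lemma baseChange_act (f : C →ₗc[R] D) (φ : D →ₗ[R] K) :
    act φ ∘ₗ (f : C →ₗ[R] D).baseChange K =
      (f : C →ₗ[R] D).baseChange K ∘ₗ act (φ ∘ₗ (f : C →ₗ[R] D)) := by
  ext x
  simp only [TensorProduct.AlgebraTensorModule.curry_apply,
    TensorProduct.curry_apply, LinearMap.coe_restrictScalars, LinearMap.comp_apply, act_one_tmul,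
    LinearMap.baseChange_tmul]
  have h := CoalgHomClass.map_comp_comul_apply f x
  have : φ.rTensor D ∘ₗ TensorProduct.map (f : C →ₗ[R] D) f =
      ((f : C →ₗ[R] D).baseChange K).restrictScalars R ∘ₗ
        (φ ∘ₗ (f : C →ₗ[R] D)).rTensor C := by
    ext; simp
  exact (congrArg (φ.rTensor D) h).symm.trans (LinearMap.congr_fun this _)

/-- A subspace of `K ⊗ C` stable under all functionals on `C`. -/
def IsActInvariant (V : Submodule K (K ⊗[R] C)) : Prop :=
  ∀ φ : C →ₗ[R] K, V ≤ V.comap (act φ)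

lemma PureSubcoalgebra.isActInvariant (X : PureSubcoalgebra R C) :
    IsActInvariant (X.carrier.baseChange K) := by
  intro φ
  rw [Submodule.baseChange_eq_span, Submodule.span_le, ← Submodule.baseChange_eq_span]
  rintro _ ⟨x, hx, rfl⟩
  obtain ⟨y, hy⟩ := X.comul_mem x hx
  simp only [TensorProduct.mk_apply, Submodule.comap_coe, Set.mem_preimage, act_one_tmul, ← hy,
    SetLike.mem_coe]
  clear hy
  induction y with
  | zero => simp
  | tmul a b => simpa using Submodule.tmul_mem_baseChange_of_mem _ b.2
  | add a b ha hb => simpa using add_mem ha hb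

/-- A comultiplication is a finite sum of pure tensors, and the right-hand factors span a space that
does not depend on `φ`. -/
lemma exists_finite_forall_act_mem (x : K ⊗[R] C) :
    ∃ V : Submodule K (K ⊗[R] C), Module.Finite K V ∧ ∀ φ : C →ₗ[R] K, act φ x ∈ V := by
  induction x with
  | zero => exact ⟨⊥, inferInstance, by simp⟩
  | add x y hx hy =>
    obtain ⟨V, _, hV⟩ := hx
    obtain ⟨W, _, hW⟩ := hy
    refine ⟨V ⊔ W, inferInstance, fun φ => ?_⟩
    rw [map_add]
    exact add_mem (Submodule.mem_sup_left (hV φ)) (Submodule.mem_sup_right (hW φ))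
  | tmul a c =>
    suffices ∀ y : C ⊗[R] C, ∃ V : Submodule K (K ⊗[R] C), Module.Finite K V ∧
        ∀ φ : C →ₗ[R] K, φ.rTensor C y ∈ V by
      obtain ⟨V, hf, hV⟩ := this (comul c)
      refine ⟨V, hf, fun φ => ?_⟩
      rw [← mul_one a, ← smul_eq_mul, ← TensorProduct.smul_tmul', map_smul, act_one_tmul]
      exact V.smul_mem a (hV φ)
    intro y
    induction y with
    | zero => exact ⟨⊥, inferInstance, by simp⟩
    | add x y hx hy =>
      obtain ⟨V, _, hV⟩ := hx
      obtain ⟨W, _, hW⟩ := hy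
      refine ⟨V ⊔ W, inferInstance, fun φ => ?_⟩
      rw [map_add]
      exact add_mem (Submodule.mem_sup_left (hV φ)) (Submodule.mem_sup_right (hW φ))
    | tmul b c =>
      refine ⟨Submodule.span K {1 ⊗ₜ c}, inferInstance, fun φ => ?_⟩
      rw [LinearMap.rTensor_tmul, ← mul_one (φ b), ← smul_eq_mul, ← TensorProduct.smul_tmul']
      exact Submodule.smul_mem _ _ (Submodule.mem_span_singleton_self _)

/-- Every element of `K ⊗ C` lies in a finite-dimensional invariant subspace. -/
lemma exists_finite_isActInvariant (x : K ⊗[R] C) :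
    ∃ V : Submodule K (K ⊗[R] C), x ∈ V ∧ IsActInvariant V ∧ Module.Finite K V := by
  obtain ⟨W, _, hW⟩ := exists_finite_forall_act_mem x
  let V := Submodule.span K (Set.range fun φ : C →ₗ[R] K => act φ x)
  have hVW : V ≤ W := Submodule.span_le.mpr (Set.range_subset_iff.mpr hW)
  refine ⟨V, ?_, fun ψ => ?_, Submodule.finiteDimensional_of_le hVW⟩
  · have : act (counitFun (R := R) (K := K) (C := C)) x = x := by simp [act_counitFun]
    rw [← this]
    exact Submodule.subset_span ⟨counitFun, by simp only [act_counitFun, Module.End.one_apply]⟩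
  · rw [Submodule.span_le]
    rintro _ ⟨φ, rfl⟩
    simp only [Submodule.comap_coe, Set.mem_preimage, ← LinearMap.comp_apply, act_comp_act]
    exact Submodule.subset_span ⟨_, rfl⟩

/-- Contraction with a `K`-valued functional. -/
noncomputable def contract (W : Type u) [AddCommGroup W] [Module R W] [Module K W]
    [IsScalarTower R K W] (φ : C →ₗ[R] K) : W ⊗[R] C →ₗ[R] W :=
  TensorProduct.lift ((LinearMap.lsmul K W).restrictScalars₁₂ R R ∘ₗ φ).flip

@[simp]
lemma contract_tmul (W : Type u) [AddCommGroup W] [Module R W] [Module K W]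
    [IsScalarTower R K W] (φ : C →ₗ[R] K) (w : W) (c : C) :
    contract W φ (w ⊗ₜ c) = φ c • w := by
  simp [contract]

/-- Rewrite `W ⊗[R] C` as `W ⊗[K] (K ⊗[R] C)` and expand along a `K`-basis of the second factor:
each coordinate is a contraction. -/
lemma eq_zero_of_forall_contract_eq_zero {W : Type u} [AddCommGroup W] [Module R W] [Module K W]
    [IsScalarTower R K W] {w : W ⊗[R] C} (h : ∀ φ : C →ₗ[R] K, contract W φ w = 0) : w = 0 := by
  classical
  let b := Module.Basis.ofVectorSpace K (K ⊗[R] C)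
  let e := TensorProduct.AlgebraTensorModule.cancelBaseChange R K K W C
  let E := (e.symm.trans (TensorProduct.equivFinsuppOfBasisRight b))
  rw [← E.map_eq_zero_iff]
  ext i
  let φ : C →ₗ[R] K := (b.coord i).restrictScalars R ∘ₗ TensorProduct.mk R K C 1
  have : (Finsupp.lapply i ∘ₗ E.toLinearMap).restrictScalars R = contract W φ := by
    ext w c
    simp [E, e, φ]
  rw [Finsupp.zero_apply, ← h φ, ← this]
  rfl

/-- `contract` consumes the second tensor factor and `act` the first; cocommutativity exchanges
them. -/
lemma contract_comul [IsCocomm R C] (φ : C →ₗ[R] K) (x : C) :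
    contract (K ⊗[R] C) φ ((TensorProduct.mk R K C 1).rTensor C (comul x)) = act φ (1 ⊗ₜ x) := by
  rw [act_one_tmul]
  conv_lhs => rw [← comm_comul R x]
  generalize (comul x : C ⊗[R] C) = y
  induction y with
  | zero => simp
  | add a b ha hb => simp only [map_add, ha, hb]
  | tmul a b => simp [TensorProduct.smul_tmul']

lemma eq_zero_of_forall_functional_eq_zero {x : K ⊗[R] C}
    (h : ∀ φ : C →ₗ[R] K, φ.liftBaseChange K x = 0) : x = 0 := by
  refine (Module.forall_dual_apply_eq_zero_iff K x).mp fun f => ?_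
  rw [← h (f.restrictScalars R ∘ₗ TensorProduct.mk R K C 1)]
  congr 1
  ext; simp

end Action

/-! ### From invariant subspaces to pure subcoalgebras. -/

section Invariant

open Coalgebra

variable {R : Type u} [CommRing R] [IsDomain R] [IsPrincipalIdealRing R] {K : Type u} [Field K]
  [Algebra R K] [IsFractionRing R K]
  {C : Type u} [AddCommGroup C] [Module R C] [Coalgebra R C] [IsCocomm R C] [Module.Flat R C]

/-- The pure subcoalgebra cut out by an invariant subspace. -/
noncomputable def IsActInvariant.pureSubcoalgebra {V : Submodule K (K ⊗[R] C)}
    (hV : IsActInvariant V) : PureSubcoalgebra R C :=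
  let T : C →ₗ[R] (K ⊗[R] C) ⧸ V := V.mkQ.restrictScalars R ∘ₗ TensorProduct.mk R K C 1
  have := isTorsionFree_of_module_fractionRing (R := R) K ((K ⊗[R] C) ⧸ V)
  have hT {x : C} : x ∈ LinearMap.ker T ↔ 1 ⊗ₜ x ∈ V := by simp [T]
  { carrier := LinearMap.ker T
    isPure := isPureSubmodule_ker T
    comul_mem := fun x hx => by
      -- Its contraction with `φ` is the class of `act φ (1 ⊗ x)` modulo `V`, which vanishes by
      -- invariance.
      have h1 : T.rTensor C (comul x) = 0 := by
        refine eq_zero_of_forall_contract_eq_zero (K := K) fun φ => ?_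
        have e : contract ((K ⊗[R] C) ⧸ V) φ ∘ₗ T.rTensor C =
            V.mkQ.restrictScalars R ∘ₗ contract (K ⊗[R] C) φ ∘ₗ
              (TensorProduct.mk R K C 1).rTensor C := by
          ext a b; simp [T]
        have e' := LinearMap.congr_fun e (comul x)
        simp only [LinearMap.comp_apply, contract_comul] at e'
        rw [e']
        exact (Submodule.Quotient.mk_eq_zero V).mpr (hV φ (hT.mp hx))
      have h2 : T.lTensor C (comul x) = 0 := by
        have e : T.lTensor C ∘ₗ (TensorProduct.comm R C C).toLinearMap =
            (TensorProduct.comm R _ C).toLinearMap ∘ₗ T.rTensor C := by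
          ext; simp
        rw [← comm_comul R x]
        refine (LinearMap.congr_fun e (comul x)).trans ?_
        rw [LinearMap.comp_apply, h1, map_zero]
      exact mem_range_map_subtype_of_mem_ker T h1 h2 }

@[simp]
lemma IsActInvariant.mem_pureSubcoalgebra {V : Submodule K (K ⊗[R] C)}
    (hV : IsActInvariant V) {x : C} : x ∈ hV.pureSubcoalgebra.carrier ↔ 1 ⊗ₜ x ∈ V := by
  simp [pureSubcoalgebra]

end Invariant

lemma PureSubcoalgebra.subtype_comul {R : Type u} [CommRing R] {C : Type u} [AddCommGroup C]
    [Module R C] [Coalgebra R C] (X : PureSubcoalgebra R C) (x : X.carrier) :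
    TensorProduct.map X.carrier.subtype X.carrier.subtype (Coalgebra.comul (R := R) x) =
      Coalgebra.comul (R := R) (x : C) :=
  LinearMap.congr_fun X.map_comul x

/-! ### Pure simple subcoalgebras as minimal ones. -/

section PureSimple

open Coalgebra

variable {R : Type u} [CommRing R] [IsDomain R] [IsPrincipalIdealRing R]

lemma isPureSubmodule_iff {M : Type u} [AddCommGroup M] [Module R M] [Module.IsTorsionFree R M]
    {N : Submodule R M} :
    IsPureSubmodule R N ↔ ∀ (r : R) (x : M), r ≠ 0 → r • x ∈ N → x ∈ N := by
  refine ⟨fun h r x hr hx => h.mem_of_smul_mem hr hx, fun h => ?_⟩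
  have : Module.IsTorsionFree R (M ⧸ N) := .of_smul_eq_zero fun r x hx => by
    obtain ⟨x, rfl⟩ := N.mkQ_surjective x
    by_cases hr : r = 0
    · exact .inl hr
    · rw [← map_smul, N.mkQ_apply, Submodule.Quotient.mk_eq_zero] at hx
      exact .inr ((Submodule.Quotient.mk_eq_zero N).mpr (h r x hr hx))
  exact isPureSubmodule_of_flat_quotient N

namespace PureSubcoalgebra

variable {C : Type u} [AddCommGroup C] [Module R C] [Coalgebra R C] [Module.Flat R C]

/-- A pure subcoalgebra of a pure subcoalgebra, as a pure subcoalgebra of the ambient coalgebra. -/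
def trans (X : PureSubcoalgebra R C) (N : PureSubcoalgebra R X.carrier) : PureSubcoalgebra R C where
  carrier := N.carrier.map X.carrier.subtype
  isPure := by
    rw [isPureSubmodule_iff]
    rintro r x hr ⟨n, hn, hx⟩
    have hxX : x ∈ X.carrier := X.isPure.mem_of_smul_mem hr (hx ▸ n.2)
    refine ⟨⟨x, hxX⟩, N.isPure.mem_of_smul_mem hr ?_, rfl⟩
    rwa [show r • (⟨x, hxX⟩ : X.carrier) = n from Subtype.ext hx.symm]
  comul_mem := by
    rintro _ ⟨n, hn, rfl⟩
    obtain ⟨z, hz⟩ := N.comul_mem n hn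
    let j : N.carrier →ₗ[R] N.carrier.map X.carrier.subtype :=
      X.carrier.subtype.restrict fun x hx => Submodule.mem_map_of_mem hx
    refine ⟨TensorProduct.map j j z, ?_⟩
    have e : TensorProduct.map (N.carrier.map X.carrier.subtype).subtype
        (N.carrier.map X.carrier.subtype).subtype ∘ₗ TensorProduct.map j j =
        TensorProduct.map X.carrier.subtype X.carrier.subtype ∘ₗ
          TensorProduct.map N.carrier.subtype N.carrier.subtype := by
      ext; rfl
    refine (LinearMap.congr_fun e z).trans ?_
    rw [LinearMap.comp_apply, hz, subtype_comul]
    rfl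

/-- A pure subcoalgebra contained in another one, as a pure subcoalgebra of the latter. -/
def restrict (X N : PureSubcoalgebra R C) (h : N.carrier ≤ X.carrier) :
    PureSubcoalgebra R X.carrier where
  carrier := N.carrier.comap X.carrier.subtype
  isPure := by
    rw [isPureSubmodule_iff]
    exact fun r x hr hx => N.isPure.mem_of_smul_mem hr hx
  comul_mem := by
    intro x hx
    obtain ⟨z, hz⟩ := N.comul_mem x hx
    let j : N.carrier →ₗ[R] N.carrier.comap X.carrier.subtype :=
      (Submodule.inclusion h).codRestrict _ fun n => n.2
    refine ⟨TensorProduct.map j j z, X.map_injective ?_⟩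
    have e : TensorProduct.map X.carrier.subtype X.carrier.subtype ∘ₗ
        TensorProduct.map (N.carrier.comap X.carrier.subtype).subtype
          (N.carrier.comap X.carrier.subtype).subtype ∘ₗ TensorProduct.map j j =
        TensorProduct.map N.carrier.subtype N.carrier.subtype := by
      ext; rfl
    refine (LinearMap.congr_fun e z).trans ?_
    rw [hz, subtype_comul]

/-- A pure subcoalgebra is pure simple if and only if it is minimal among the nonzero ones. -/
lemma isPureSimple_iff (X : PureSubcoalgebra R C) :
    IsPureSimple R X.carrier ↔ X.carrier ≠ ⊥ ∧
      ∀ N : PureSubcoalgebra R C, N.carrier ≤ X.carrier → N.carrier ≠ ⊥ → X.carrier ≤ N.carrier := by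
  rw [IsPureSimple, Submodule.nontrivial_iff_ne_bot]
  refine and_congr_right fun _ => ⟨fun h N hNX hN => ?_, fun h N => ?_⟩
  · rcases h (X.restrict N hNX) with h | h
    · refine absurd (le_bot_iff.mp fun n hn => ?_) hN
      have : (⟨n, hNX hn⟩ : X.carrier) ∈ (X.restrict N hNX).carrier := hn
      rw [h, Submodule.mem_bot] at this
      exact (Submodule.mem_bot R).mpr (congrArg Subtype.val this)
    · intro x hx
      have : (⟨x, hx⟩ : X.carrier) ∈ (X.restrict N hNX).carrier := h ▸ Submodule.mem_top
      exact this
  · refine or_iff_not_imp_left.mpr fun hN => eq_top_iff.mpr fun x _ => ?_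
    obtain ⟨y, hy, hyx⟩ := h (X.trans N) (Submodule.map_subtype_le _ _)
      (fun e => hN (Submodule.map_injective_of_injective X.carrier.injective_subtype (by rw [Submodule.map_bot]; exact e))) x.2
    rwa [← Subtype.ext hyx]

/-- A nonzero pure subcoalgebra on which the counit is injective is isomorphic to the ground
ring. -/
lemma nonempty_coalgEquiv (X : PureSubcoalgebra R C) (hX : X.carrier ≠ ⊥)
    (h : ∀ x ∈ X.carrier, counit (R := R) x = 0 → x = 0) : Nonempty (X.carrier ≃ₗc[R] R) := by
  let f := counitCoalgHom R X.carrier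
  have hf (x : X.carrier) : f x = counit (R := R) (x : C) := rfl
  have hinj : Function.Injective f := (injective_iff_map_eq_zero f).mpr fun x hx =>
    Subtype.ext (h x x.2 (by rwa [← hf]))
  let I : Ideal R := LinearMap.range (f : X.carrier →ₗ[R] R)
  -- Applying the counit to both factors of the comultiplication and multiplying gives the counit
  -- back, so `I ≤ I * I`. A finitely generated idempotent ideal of a domain is `0` or everything.
  have hI : IsIdempotentElem I := by
    refine le_antisymm Ideal.mul_le_right ?_
    rintro _ ⟨x, rfl⟩
    have : LinearMap.mul' R R (TensorProduct.map (f : X.carrier →ₗ[R] R) (f : X.carrier →ₗ[R] R) (Coalgebra.comul (R := R) x)) = f x := by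
      rw [CoalgHomClass.map_comp_comul_apply]
      simp
    rw [← CoalgHom.coe_toLinearMap] at this
    rw [← this]
    have hmem (a : X.carrier) : f a ∈ I := ⟨a, rfl⟩
    generalize Coalgebra.comul (R := R) x = y
    induction y with
    | zero => simp
    | add a b ha hb => simpa using add_mem ha hb
    | tmul a b => simpa using Ideal.mul_mem_mul (hmem a) (hmem b)
  obtain ⟨e, he, hIe⟩ := (Ideal.isIdempotentElem_iff_of_fg I
    (IsNoetherian.noetherian I)).mp hI
  obtain ⟨x, hx, hx0⟩ := Submodule.exists_mem_ne_zero_of_ne_bot hX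
  rcases IsIdempotentElem.iff_eq_zero_or_one.mp he with rfl | rfl
  · refine absurd (h x hx ?_) hx0
    have : f ⟨x, hx⟩ ∈ I := ⟨_, rfl⟩
    rwa [hIe, Submodule.span_zero_singleton, Submodule.mem_bot, hf] at this
  · refine ⟨CoalgEquiv.ofBijective (f := f) ⟨hinj, fun r => ?_⟩⟩
    have : r ∈ I := by simp [hIe]
    exact this

end PureSubcoalgebra

end PureSimple

/-! ### Vectors killed by split polynomials. -/

section Split

open Polynomial

variable {K V W : Type*} [Field K] [AddCommGroup V] [Module K V] [AddCommGroup W] [Module K W]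

/-- The vectors killed by a nonzero split polynomial in `T`. -/
def splitSubmodule (T : Module.End K V) : Submodule K V where
  carrier := {x | ∃ p : K[X], p ≠ 0 ∧ p.Splits ∧ aeval T p x = 0}
  zero_mem' := ⟨1, one_ne_zero, Splits.one, map_zero _⟩
  add_mem' := by
    rintro x y ⟨p, hp, hps, hx⟩ ⟨q, hq, hqs, hy⟩
    refine ⟨p * q, mul_ne_zero hp hq, hps.mul hqs, ?_⟩
    rw [map_add, map_mul, Module.End.mul_apply, Module.End.mul_apply, hy, map_zero, add_zero,
      ← Module.End.mul_apply, ← map_mul, mul_comm, map_mul, Module.End.mul_apply, hx, map_zero]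
  smul_mem' := by
    rintro a x ⟨p, hp, hps, hx⟩
    exact ⟨p, hp, hps, by rw [map_smul, hx, smul_zero]⟩

lemma aeval_apply_of_comp_eq {T : Module.End K V} {S : Module.End K W} {f : V →ₗ[K] W}
    (h : S ∘ₗ f = f ∘ₗ T) (p : K[X]) (x : V) : aeval S p (f x) = f (aeval T p x) := by
  induction p using Polynomial.induction_on' generalizing x with
  | add p q hp hq => simp [hp, hq]
  | monomial n a =>
    simp only [aeval_monomial, Module.End.mul_apply, Module.algebraMap_end_apply, map_smul]
    congr 1
    induction n generalizing x with
    | zero => simp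
    | succ n ih =>
      rw [pow_succ, pow_succ, Module.End.mul_apply, Module.End.mul_apply, ← ih]
      exact congrArg (S ^ n) (LinearMap.congr_fun h x)

lemma map_mem_splitSubmodule {T : Module.End K V} {S : Module.End K W} {f : V →ₗ[K] W}
    (h : S ∘ₗ f = f ∘ₗ T) {x : V} (hx : x ∈ splitSubmodule T) : f x ∈ splitSubmodule S := by
  obtain ⟨p, hp, hps, hx⟩ := hx
  exact ⟨p, hp, hps, by rw [aeval_apply_of_comp_eq h, hx, map_zero]⟩

lemma mem_splitSubmodule_of_map {T : Module.End K V} {S : Module.End K W} {f : V →ₗ[K] W}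
    (h : S ∘ₗ f = f ∘ₗ T) (hf : Function.Injective f) {x : V} (hx : f x ∈ splitSubmodule S) :
    x ∈ splitSubmodule T := by
  obtain ⟨p, hp, hps, hx⟩ := hx
  exact ⟨p, hp, hps, hf (by rw [← aeval_apply_of_comp_eq h, hx, map_zero])⟩

lemma aeval_apply_mem {T : Module.End K V} {U : Submodule K V} (hU : U ≤ U.comap T) (p : K[X])
    {x : V} (hx : x ∈ U) : aeval T p x ∈ U := by
  have h : T ∘ₗ U.subtype = U.subtype ∘ₗ T.restrict hU := rfl
  exact aeval_apply_of_comp_eq h p ⟨x, hx⟩ ▸ Subtype.property _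

/-- A nonzero vector of an invariant subspace killed by a split polynomial gives an eigenvector in
the subspace. -/
lemma exists_eigenvector_of_mem_splitSubmodule {T : Module.End K V} {U : Submodule K V}
    (hU : U ≤ U.comap T) {x : V} (hxU : x ∈ U) (hx0 : x ≠ 0) (hx : x ∈ splitSubmodule T) :
    ∃ y ∈ U, y ≠ 0 ∧ ∃ μ : K, T y = μ • y := by
  obtain ⟨p, hp, hps, hpx⟩ := hx
  rw [hps.eq_prod_roots, map_mul, aeval_C, Module.End.mul_apply, Module.algebraMap_end_apply,
    smul_eq_zero, leadingCoeff_eq_zero, or_iff_right hp] at hpx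
  generalize p.roots = s at hpx
  induction s using Multiset.induction_on with
  | empty => exact absurd (by simpa using hpx) hx0
  | cons a s ih =>
    by_cases h : aeval T (s.map fun a => X - C a).prod x = 0
    · exact ih h
    · refine ⟨_, aeval_apply_mem hU _ hxU, h, a, ?_⟩
      rw [Multiset.map_cons, Multiset.prod_cons, map_mul, Module.End.mul_apply] at hpx
      simpa [sub_eq_zero] using hpx

lemma exists_aeval_apply_eq_zero (T : Module.End K V) {U : Submodule K V} [Module.Finite K U]
    (hU : U ≤ U.comap T) {x : V} (hx : x ∈ U) : ∃ p : K[X], p ≠ 0 ∧ aeval T p x = 0 := by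
  let F : K[X] →ₗ[K] U :=
    ((LinearMap.applyₗ x) ∘ₗ (aeval T).toLinearMap).codRestrict U fun p => aeval_apply_mem hU p hx
  have hF : ¬ Function.Injective ⇑F := fun h => Polynomial.not_finite (Module.Finite.of_injective F h)
  rw [← LinearMap.ker_eq_bot] at hF
  obtain ⟨p, hp, hp0⟩ := Submodule.exists_mem_ne_zero_of_ne_bot hF
  exact ⟨p, hp0, congrArg Subtype.val hp⟩

end Split

/-! ### The split-polynomial criterion for pointedness. -/

section Pointed

open Coalgebra Polynomial

variable {R : Type u} [CommRing R] [IsDomain R] [IsPrincipalIdealRing R] {K : Type u} [Field K]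
  [Algebra R K] [IsFractionRing R K]
  {C : Type u} [AddCommGroup C] [Module R C] [Coalgebra R C] [IsCocomm R C] [Module.Flat R C]

lemma IsActInvariant.inf {U V : Submodule K (K ⊗[R] C)} (hU : IsActInvariant U)
    (hV : IsActInvariant V) : IsActInvariant (U ⊓ V) :=
  fun φ _ hx => ⟨hU φ hx.1, hV φ hx.2⟩

lemma isActInvariant_ker_of_commute {T : Module.End K (K ⊗[R] C)}
    (hT : ∀ φ : C →ₗ[R] K, Commute T (act φ)) : IsActInvariant (LinearMap.ker T) := by
  intro φ x hx
  have : T (act φ x) = act φ (T x) := LinearMap.congr_fun (hT φ) x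
  rw [Submodule.mem_comap, LinearMap.mem_ker, this, hx, map_zero]

lemma IsActInvariant.pureSubcoalgebra_ne_bot {V : Submodule K (K ⊗[R] C)}
    (hV : IsActInvariant V) (h : V ≠ ⊥) : hV.pureSubcoalgebra.carrier ≠ ⊥ := by
  obtain ⟨v, hv, hv0⟩ := Submodule.exists_mem_ne_zero_of_ne_bot h
  obtain ⟨r, m, hr, hm⟩ := exists_smul_eq_one_tmul v
  refine Submodule.ne_bot_iff _ |>.mpr ⟨m, ?_, ?_⟩
  · rw [hV.mem_pureSubcoalgebra, ← hm]
    exact (V.restrictScalars R).smul_mem r hv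
  · rintro rfl
    have := isTorsionFree_of_module_fractionRing (R := R) K (K ⊗[R] C)
    rw [TensorProduct.tmul_zero, smul_eq_zero] at hm
    exact hm.elim hr hv0

lemma PureSubcoalgebra.baseChange_le_iff {X : PureSubcoalgebra R C}
    {V : Submodule K (K ⊗[R] C)} :
    X.carrier.baseChange K ≤ V ↔ ∀ x ∈ X.carrier, 1 ⊗ₜ x ∈ V := by
  rw [Submodule.baseChange_eq_span, Submodule.span_le]
  simp [Set.subset_def]

lemma PureSubcoalgebra.baseChange_ne_bot {X : PureSubcoalgebra R C} (hX : X.carrier ≠ ⊥) :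
    X.carrier.baseChange K ≠ ⊥ := by
  obtain ⟨x, hx, hx0⟩ := Submodule.exists_mem_ne_zero_of_ne_bot hX
  refine (Submodule.ne_bot_iff _).mpr ⟨1 ⊗ₜ x, Submodule.tmul_mem_baseChange_of_mem _ hx, ?_⟩
  intro h
  exact hx0 (tmul_one_injective K (h.trans (TensorProduct.tmul_zero _ _).symm))

/-- Choose a nonzero finite-dimensional invariant subspace of least dimension; one exists by local
finiteness. -/
lemma exists_minimal_isActInvariant {V : Submodule K (K ⊗[R] C)} (hV : IsActInvariant V)
    (h : V ≠ ⊥) : ∃ U ≤ V, IsActInvariant U ∧ U ≠ ⊥ ∧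
      ∀ W ≤ U, IsActInvariant W → W ≠ ⊥ → U ≤ W := by
  classical
  have hex : ∃ n : ℕ, ∃ U ≤ V, IsActInvariant U ∧ U ≠ ⊥ ∧ Module.Finite K U ∧
      Module.finrank K U = n := by
    obtain ⟨v, hv, hv0⟩ := Submodule.exists_mem_ne_zero_of_ne_bot h
    obtain ⟨U, hvU, hU, hfin⟩ := exists_finite_isActInvariant v
    exact ⟨_, U ⊓ V, inf_le_right, hU.inf hV, (Submodule.ne_bot_iff _).mpr ⟨v, ⟨hvU, hv⟩, hv0⟩,
      Submodule.finiteDimensional_of_le inf_le_left, rfl⟩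
  obtain ⟨U, hUV, hU, hU0, hfin, hn⟩ := Nat.find_spec hex
  refine ⟨U, hUV, hU, hU0, fun W hWU hW hW0 => ?_⟩
  refine (Submodule.eq_of_le_of_finrank_le hWU ?_).ge
  rw [hn]
  exact Nat.find_min' hex ⟨W, hWU.trans hUV, hW, hW0, Submodule.finiteDimensional_of_le hWU, rfl⟩

/-- A minimal invariant subspace cuts out a pure simple subcoalgebra. Pointedness makes it free of
rank one, so its span over `K` is an invariant line. -/
lemma IsPointedCoalgebra.exists_eigenvector (hC : IsPointedCoalgebra R C)
    {V : Submodule K (K ⊗[R] C)} (hV : IsActInvariant V) (h : V ≠ ⊥) :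
    ∃ x ∈ V, x ≠ 0 ∧ ∀ φ : C →ₗ[R] K, ∃ μ : K, act φ x = μ • x := by
  obtain ⟨U, hUV, hU, hU0, hmin⟩ := exists_minimal_isActInvariant hV h
  let X := hU.pureSubcoalgebra
  have hX0 : X.carrier ≠ ⊥ := hU.pureSubcoalgebra_ne_bot hU0
  have hX : IsPureSimple R X.carrier := by
    refine X.isPureSimple_iff.mpr ⟨hX0, fun N hNX hN x hx => ?_⟩
    refine N.isPure.one_tmul_mem_baseChange K (hmin _ ?_ N.isActInvariant
      (PureSubcoalgebra.baseChange_ne_bot hN) (hU.mem_pureSubcoalgebra.mp hx))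
    exact PureSubcoalgebra.baseChange_le_iff.mpr fun n hn => hU.mem_pureSubcoalgebra.mp (hNX hn)
  obtain ⟨e⟩ := hC X hX
  let g : X.carrier := e.symm 1
  have hg (x : X.carrier) : x = e x • g := by
    apply e.injective
    simp [g, map_smul]
  have hspan : X.carrier = Submodule.span R {(g : C)} := by
    refine le_antisymm (fun x hx => ?_) ((Submodule.span_singleton_le_iff_mem _ _).mpr g.2)
    exact Submodule.mem_span_singleton.mpr ⟨e ⟨x, hx⟩, (congrArg Subtype.val (hg ⟨x, hx⟩)).symm⟩
  refine ⟨1 ⊗ₜ (g : C), hUV (hU.mem_pureSubcoalgebra.mp g.2), fun h0 => hX0 ?_, fun φ => ?_⟩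
  · rw [hspan, Submodule.span_singleton_eq_bot]
    exact tmul_one_injective K (h0.trans (TensorProduct.tmul_zero _ _).symm)
  · have hspan' : X.carrier.baseChange K = Submodule.span K {1 ⊗ₜ (g : C)} := by
      conv_lhs => rw [hspan, Submodule.baseChange_span, Set.image_singleton]
      rfl
    have := X.isActInvariant φ (Submodule.tmul_mem_baseChange_of_mem (1 : K) g.2)
    rw [Submodule.mem_comap, hspan', Submodule.mem_span_singleton] at this
    obtain ⟨μ, hμ⟩ := this
    exact ⟨μ, hμ.symm⟩

lemma IsPointedCoalgebra.splitSubmodule_act (hC : IsPointedCoalgebra R C) (φ : C →ₗ[R] K) :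
    splitSubmodule (act φ) = ⊤ := by
  have hcomm (p : K[X]) (ψ : C →ₗ[R] K) : Commute (aeval (act φ) p) (act ψ) :=
    LinearMap.ext fun x => aeval_apply_of_comp_eq (act_commute φ ψ) p x
  have key (p : K[X]) : p ≠ 0 → ∀ x, aeval (act φ) p x = 0 → x ∈ splitSubmodule (act φ) := by
    induction p using WfDvdMonoid.induction_on_irreducible with
    | zero => exact fun h => absurd rfl h
    | unit p hp =>
      intro _ x hx
      obtain ⟨a, ha, rfl⟩ := Polynomial.isUnit_iff.mp hp
      have : x = 0 := by simpa [ha.ne_zero] using hx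
      exact this ▸ zero_mem _
    | mul p q hp hq ih =>
      intro _ x hx
      rw [map_mul, ← map_mul, mul_comm, map_mul, Module.End.mul_apply] at hx
      obtain ⟨f, hf, hfs, hfx⟩ := ih hp _ hx
      have hz : aeval (act φ) q (aeval (act φ) f x) = 0 := by
        rw [← Module.End.mul_apply, ← map_mul, mul_comm, map_mul, Module.End.mul_apply, hfx]
      -- Unless `f` already kills `x`, the kernel of `q(act φ)` is a nonzero invariant subspace. An
      -- eigenvector in it makes its eigenvalue a root of the irreducible `q`, which is therefore
      -- linear.
      by_cases hz0 : aeval (act φ) f x = 0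
      · exact ⟨f, hf, hfs, hz0⟩
      · obtain ⟨y, hy, hy0, hy'⟩ := hC.exists_eigenvector
          (isActInvariant_ker_of_commute (hcomm q))
          ((Submodule.ne_bot_iff _).mpr ⟨_, LinearMap.mem_ker.mpr hz, hz0⟩)
        obtain ⟨μ, hμ⟩ := hy' φ
        rw [LinearMap.mem_ker, Module.End.aeval_apply_of_hasEigenvector
          ⟨Module.End.mem_eigenspace_iff.mpr hμ, hy0⟩, smul_eq_zero, or_iff_left hy0] at hy
        have hqs : q.Splits :=
          .of_degree_le_one (Polynomial.degree_eq_one_of_irreducible_of_root hq hy).le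
        refine ⟨f * q, mul_ne_zero hf hq.ne_zero, hfs.mul hqs, ?_⟩
        rw [mul_comm, map_mul, Module.End.mul_apply, hz]
  refine eq_top_iff.mpr fun x _ => ?_
  obtain ⟨U, hxU, hU, hfin⟩ := exists_finite_isActInvariant x
  obtain ⟨p, hp0, hp⟩ := exists_aeval_apply_eq_zero (act φ) (hU φ) hxU
  exact key p hp0 x hp

/-- Schur's lemma: an operator that is locally split acts on a pure simple subcoalgebra as a
scalar. -/
lemma PureSubcoalgebra.exists_act_eq_smul (S : PureSubcoalgebra R C)
    (hS : IsPureSimple R S.carrier) {φ : C →ₗ[R] K} (hφ : splitSubmodule (act φ) = ⊤) :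
    ∃ μ : K, ∀ x ∈ S.carrier, act φ (1 ⊗ₜ x) = μ • (1 ⊗ₜ x) := by
  rw [S.isPureSimple_iff] at hS
  obtain ⟨x, hx, hx0⟩ := Submodule.exists_mem_ne_zero_of_ne_bot (baseChange_ne_bot (K := K) hS.1)
  obtain ⟨y, hy, hy0, μ, hμ⟩ := exists_eigenvector_of_mem_splitSubmodule
    (S.isActInvariant φ) hx hx0 (hφ ▸ Submodule.mem_top)
  -- The eigenspace is invariant because the operators commute; its trace on `S` is a nonzero pure
  -- subcoalgebra, hence all of `S`.
  have hE : IsActInvariant (LinearMap.ker (act φ - algebraMap K _ μ)) :=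
    isActInvariant_ker_of_commute fun ψ => by
      refine LinearMap.ext fun x => ?_
      have h1 : act φ (act ψ x) = act ψ (act φ x) := LinearMap.congr_fun (act_commute φ ψ) x
      simp [h1]
  have hV := (S.isActInvariant (K := K)).inf hE
  refine ⟨μ, fun s hs => ?_⟩
  have : s ∈ hV.pureSubcoalgebra.carrier := by
    refine hS.2 _ (fun z hz => ?_) (hV.pureSubcoalgebra_ne_bot ?_) hs
    · exact S.isPure.one_tmul_mem_baseChange K (hV.mem_pureSubcoalgebra.mp hz).1
    · exact (Submodule.ne_bot_iff _).mpr ⟨y, ⟨hy, by simp [hμ]⟩, hy0⟩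
  simpa [sub_eq_zero] using (hV.mem_pureSubcoalgebra.mp this).2

lemma apply_eq_of_act_eq_smul {φ : C →ₗ[R] K} {μ : K} {x : C}
    (h : act φ (1 ⊗ₜ x) = μ • (1 ⊗ₜ x)) : φ x = μ * algebraMap R K (counit x) := by
  have := LinearMap.congr_fun (counitFun_act φ) (1 ⊗ₜ x)
  rw [LinearMap.comp_apply, h, map_smul] at this
  simpa [counitFun] using this.symm

lemma eq_zero_of_forall_functional_apply_eq_zero {x : C} (h : ∀ φ : C →ₗ[R] K, φ x = 0) :
    x = 0 := by
  refine tmul_one_injective (R := R) K ?_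
  rw [map_zero]
  exact eq_zero_of_forall_functional_eq_zero fun φ => by simp [h]

/-- On a pure simple subcoalgebra every functional is a multiple of the counit. Functionals separate
points, so the counit is injective there. -/
lemma isPointedCoalgebra_of_splitSubmodule_act
    (h : ∀ φ : C →ₗ[R] K, splitSubmodule (act φ) = ⊤) : IsPointedCoalgebra R C := by
  intro S hS
  refine S.nonempty_coalgEquiv (S.isPureSimple_iff.mp hS).1 fun x hx hx0 => ?_
  refine eq_zero_of_forall_functional_apply_eq_zero (R := R) (K := K) fun φ => ?_
  obtain ⟨μ, hμ⟩ := S.exists_act_eq_smul hS (h φ)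
  rw [apply_eq_of_act_eq_smul (hμ x hx), hx0, map_zero, mul_zero]

end Pointed

/-! ### Closure properties of pointed coalgebras. -/

section PointedClosure

open Coalgebra

variable {R : Type u} [CommRing R] [IsDomain R] [IsPrincipalIdealRing R]
  {K : Type u} [Field K] [Algebra R K] [IsFractionRing R K]
  {C D : Type u} [AddCommGroup C] [Module R C] [Coalgebra R C] [IsCocomm R C] [Module.Flat R C]
  [AddCommGroup D] [Module R D] [Coalgebra R D] [IsCocomm R D] [Module.Flat R D]

lemma baseChange_injective {M N : Type u} [AddCommGroup M] [Module R M] [AddCommGroup N]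
    [Module R N] {f : M →ₗ[R] N} (hf : Function.Injective f) :
    Function.Injective (f.baseChange K) :=
  have : Module.Flat R K := IsLocalization.flat K (nonZeroDivisors R)
  Module.Flat.lTensor_preserves_injective_linearMap f hf

lemma IsPointedCoalgebra.of_injective (hD : IsPointedCoalgebra R D) (f : C →ₗc[R] D)
    (hf : Function.Injective f) : IsPointedCoalgebra R C := by
  let K := FractionRing R
  refine isPointedCoalgebra_of_splitSubmodule_act (K := K) fun φ => eq_top_iff.mpr fun x _ => ?_
  have hinj : Function.Injective ((f : C →ₗ[R] D).baseChange K) := baseChange_injective hf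
  -- A `K`-linear retraction extends `φ` to a functional `ψ` on `D`, and `act φ` becomes the
  -- restriction of `act ψ`.
  obtain ⟨g, hg⟩ := LinearMap.exists_leftInverse_of_injective _ (LinearMap.ker_eq_bot.mpr hinj)
  let ψ : D →ₗ[R] K := (φ.liftBaseChange K ∘ₗ g).restrictScalars R ∘ₗ TensorProduct.mk R K D 1
  have hψ : ψ ∘ₗ (f : C →ₗ[R] D) = φ := by
    ext c
    have : g (1 ⊗ₜ f c) = 1 ⊗ₜ c := LinearMap.congr_fun hg (1 ⊗ₜ c)
    simp [ψ, this]
  have h := baseChange_act f ψ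
  rw [hψ] at h
  exact mem_splitSubmodule_of_map h hinj (hD.splitSubmodule_act ψ ▸ Submodule.mem_top)

lemma isPointedCoalgebra_of_iSup_range_eq_top (K : Type u) [Field K] [Algebra R K]
    [IsFractionRing R K] {ι : Type*} {X : ι → Type u}
    [∀ i, AddCommGroup (X i)] [∀ i, Module R (X i)] [∀ i, Coalgebra R (X i)]
    [∀ i, IsCocomm R (X i)] [∀ i, Module.Flat R (X i)] (hX : ∀ i, IsPointedCoalgebra R (X i))
    (f : ∀ i, X i →ₗc[R] C)
    (hf : ⨆ i, LinearMap.range ((f i : X i →ₗ[R] C).baseChange K) = ⊤) :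
    IsPointedCoalgebra R C := by
  refine isPointedCoalgebra_of_splitSubmodule_act (K := K) fun φ => eq_top_iff.mpr ?_
  rw [← hf]
  refine iSup_le fun i => ?_
  rintro _ ⟨x, rfl⟩
  exact map_mem_splitSubmodule (baseChange_act (f i) φ)
    ((hX i).splitSubmodule_act (φ ∘ₗ (f i : X i →ₗ[R] C)) ▸ Submodule.mem_top)

lemma isPointedCoalgebra_self : IsPointedCoalgebra R R := by
  intro S hS
  exact S.nonempty_coalgEquiv (S.isPureSimple_iff.mp hS).1 fun x _ hx => hx

/-- The functional `φ ⊗ ε` on `C ⊗ D`. -/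
noncomputable def tensorCounit (D : Type u) [AddCommGroup D] [Module R D] [Coalgebra R D]
    (φ : C →ₗ[R] K) : C ⊗[R] D →ₗ[R] K :=
  (TensorProduct.rid R K).toLinearMap ∘ₗ TensorProduct.map φ counit

/-- The functional `ε ⊗ ψ` on `C ⊗ D`. -/
noncomputable def counitTensor (C : Type u) [AddCommGroup C] [Module R C] [Coalgebra R C]
    (ψ : D →ₗ[R] K) : C ⊗[R] D →ₗ[R] K :=
  (TensorProduct.lid R K).toLinearMap ∘ₗ TensorProduct.map counit ψ

@[simp]
lemma tensorCounit_tmul (φ : C →ₗ[R] K) (c : C) (d : D) :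
    tensorCounit D φ (c ⊗ₜ d) = counit (R := R) d • φ c := by
  simp [tensorCounit]

@[simp]
lemma counitTensor_tmul (ψ : D →ₗ[R] K) (c : C) (d : D) :
    counitTensor C ψ (c ⊗ₜ d) = counit (R := R) c • ψ d := by
  simp [counitTensor]

/-- The operator of `φ ⊗ ε` touches only the factor `C`, so it inherits local splitness from `act
φ`. -/
lemma act_tensorCounit_comp (φ : C →ₗ[R] K) (d : D) :
    act (tensorCounit D φ) ∘ₗ ((TensorProduct.mk R C D).flip d).baseChange K =
      ((TensorProduct.mk R C D).flip d).baseChange K ∘ₗ act φ := by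
  ext c
  simp only [TensorProduct.AlgebraTensorModule.curry_apply, TensorProduct.curry_apply,
    LinearMap.coe_restrictScalars, LinearMap.comp_apply, act_one_tmul, LinearMap.baseChange_tmul,
    LinearMap.flip_apply, TensorProduct.mk_apply, TensorProduct.comul_tmul]
  generalize (comul c : C ⊗[R] C) = y
  induction y with
  | zero => simp
  | add a b ha hb => simp only [map_add, TensorProduct.add_tmul, ha, hb]
  | tmul a b =>
    have h (z : D ⊗[R] D) : (tensorCounit D φ).rTensor (C ⊗[R] D)
        (TensorProduct.AlgebraTensorModule.tensorTensorTensorComm R R R R C C D D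
          ((a ⊗ₜ b) ⊗ₜ z)) =
        φ a ⊗ₜ (b ⊗ₜ TensorProduct.lid R D (counit.rTensor D z)) := by
      induction z with
      | zero => simp
      | add u v hu hv => simp only [map_add, TensorProduct.tmul_add, hu, hv]
      | tmul u v => simp [TensorProduct.smul_tmul]
    rw [h, rTensor_counit_comul]
    simp

lemma act_counitTensor_comp (ψ : D →ₗ[R] K) (c : C) :
    act (counitTensor C ψ) ∘ₗ (TensorProduct.mk R C D c).baseChange K =
      (TensorProduct.mk R C D c).baseChange K ∘ₗ act ψ := by
  ext d
  simp only [TensorProduct.AlgebraTensorModule.curry_apply, TensorProduct.curry_apply,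
    LinearMap.coe_restrictScalars, LinearMap.comp_apply, act_one_tmul, LinearMap.baseChange_tmul,
    TensorProduct.mk_apply, TensorProduct.comul_tmul]
  generalize (comul d : D ⊗[R] D) = y
  induction y with
  | zero => simp
  | add a b ha hb => simp only [map_add, TensorProduct.tmul_add, ha, hb]
  | tmul a b =>
    have h (z : C ⊗[R] C) : (counitTensor C ψ).rTensor (C ⊗[R] D)
        (TensorProduct.AlgebraTensorModule.tensorTensorTensorComm R R R R C C D D
          (z ⊗ₜ (a ⊗ₜ b))) =
        ψ a ⊗ₜ (TensorProduct.lid R C (counit.rTensor C z) ⊗ₜ b) := by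
      induction z with
      | zero => simp
      | add u v hu hv => simp only [map_add, TensorProduct.tmul_add, TensorProduct.add_tmul, hu, hv]
      | tmul u v => simp [TensorProduct.smul_tmul]
    rw [h, rTensor_counit_comul]
    simp

lemma splitSubmodule_act_tensorCounit (hC : IsPointedCoalgebra R C) (φ : C →ₗ[R] K) :
    splitSubmodule (act (tensorCounit D φ)) = ⊤ := by
  rw [eq_top_iff, ← Submodule.baseChange_top, ← TensorProduct.span_tmul_eq_top,
    Submodule.baseChange_span, Submodule.span_le]
  rintro _ ⟨_, ⟨c, d, rfl⟩, rfl⟩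
  exact map_mem_splitSubmodule (act_tensorCounit_comp φ d) (x := 1 ⊗ₜ c)
    (hC.splitSubmodule_act φ ▸ Submodule.mem_top)

lemma splitSubmodule_act_counitTensor (hD : IsPointedCoalgebra R D) (ψ : D →ₗ[R] K) :
    splitSubmodule (act (counitTensor C ψ)) = ⊤ := by
  rw [eq_top_iff, ← Submodule.baseChange_top, ← TensorProduct.span_tmul_eq_top,
    Submodule.baseChange_span, Submodule.span_le]
  rintro _ ⟨_, ⟨c, d, rfl⟩, rfl⟩
  exact map_mem_splitSubmodule (act_counitTensor_comp ψ c) (x := 1 ⊗ₜ d)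
    (hD.splitSubmodule_act ψ ▸ Submodule.mem_top)

/-- Both sides are the value of `φ ⊗ ψ` at `s`. -/
lemma counitTensor_act_tensorCounit (φ : C →ₗ[R] K) (ψ : D →ₗ[R] K) (s : C ⊗[R] D) :
    (counitTensor C ψ).liftBaseChange K (act (tensorCounit D φ) (1 ⊗ₜ s)) =
      φ.liftBaseChange K (contract (K ⊗[R] C) ψ ((TensorProduct.mk R K C 1).rTensor D s)) := by
  induction s with
  | zero => simp
  | add a b ha hb => simp only [map_add, TensorProduct.tmul_add, ha, hb]
  | tmul c d =>
    have h1 := LinearMap.congr_fun (act_tensorCounit_comp φ d) (1 ⊗ₜ c)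
    simp only [LinearMap.comp_apply, LinearMap.baseChange_tmul, LinearMap.flip_apply,
      TensorProduct.mk_apply] at h1
    have h2 : (counitTensor C ψ).liftBaseChange K ∘ₗ
        ((TensorProduct.mk R C D).flip d).baseChange K = ψ d • counitFun.liftBaseChange K := by
      ext c
      simp [counitFun, Algebra.smul_def, mul_comm]
    rw [h1, ← LinearMap.comp_apply, h2, LinearMap.smul_apply, ← LinearMap.comp_apply,
      counitFun_act]
    simp

/-- The tensor product of pointed coalgebras is pointed. -/
lemma IsPointedCoalgebra.tensor (hC : IsPointedCoalgebra R C) (hD : IsPointedCoalgebra R D) :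
    IsPointedCoalgebra R (C ⊗[R] D) := by
  let K := FractionRing R
  intro S hS
  refine S.nonempty_coalgEquiv (S.isPureSimple_iff.mp hS).1 fun s hs hs0 => ?_
  -- The functionals `φ ⊗ ψ` separate points of `C ⊗ D`. Since `φ ⊗ ε` and `ε ⊗ ψ` act on `S` as
  -- scalars `μ` and `ν`, the value of `φ ⊗ ψ` at `s` is `μ * ν` times the counit of `s`, which is
  -- zero.
  have hw : (TensorProduct.mk R K C 1).rTensor D s = 0 := by
    refine eq_zero_of_forall_contract_eq_zero (K := K) fun ψ => ?_
    refine eq_zero_of_forall_functional_eq_zero fun φ => ?_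
    obtain ⟨μ, hμ⟩ := S.exists_act_eq_smul hS (splitSubmodule_act_tensorCounit (D := D) hC φ)
    obtain ⟨ν, hν⟩ := S.exists_act_eq_smul hS (splitSubmodule_act_counitTensor (C := C) hD ψ)
    rw [← counitTensor_act_tensorCounit, hμ s hs, map_smul, LinearMap.liftBaseChange_tmul,
      apply_eq_of_act_eq_smul (hν s hs), hs0]
    simp
  exact Module.Flat.rTensor_preserves_injective_linearMap (M := D) _ (tmul_one_injective K)
    (hw.trans (map_zero _).symm)

end PointedClosure

/-! ### Colimits of flat modules, by killing torsion. -/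

section FlatModules

open Limits

variable (R : Type u) [CommRing R]

instance (M : FlatMod R) : Module.Flat R M.obj := M.property

/-- A flat module, as an object of `FlatMod R`. -/
abbrev FlatMod.of (M : Type u) [AddCommGroup M] [Module R M] [Module.Flat R M] : FlatMod R :=
  ⟨ModuleCat.of R M, ‹_›⟩

variable {R}

/-- A linear map between flat modules, as a morphism of `FlatMod R`. -/
abbrev FlatMod.ofHom {M N : Type u} [AddCommGroup M] [Module R M] [Module.Flat R M]
    [AddCommGroup N] [Module R N] [Module.Flat R N] (f : M →ₗ[R] N) :
    FlatMod.of R M ⟶ FlatMod.of R N :=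
  ObjectProperty.homMk (ModuleCat.ofHom f)

variable (R) [IsDomain R] [IsPrincipalIdealRing R]

instance (M : Type u) [AddCommGroup M] [Module R M] :
    Module.Flat R (M ⧸ Submodule.torsion R M) := inferInstance

/-- Morphisms from the torsion-free quotient of `M` to a flat module are morphisms from `M`. -/
noncomputable def torsionFreeQuotientHomEquiv (M : ModuleCat.{u} R) (N : FlatMod R) :
    (FlatMod.of R (M ⧸ Submodule.torsion R M) ⟶ N) ≃ (M ⟶ (flatModules R).ι.obj N) where
  toFun f := ModuleCat.ofHom (f.hom.hom ∘ₗ (Submodule.torsion R M).mkQ)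
  invFun g := ObjectProperty.homMk (ModuleCat.ofHom ((Submodule.torsion R M).liftQ g.hom
    fun x hx => by
      obtain ⟨r, hr⟩ := (Submodule.mem_torsion_iff x).mp hx
      have : Module.IsTorsionFree R N.obj := Module.Flat.isTorsionFree
      have h : (r : R) • (show N.obj from g.hom x) = 0 :=
        (g.hom.map_smul (r : R) x).symm.trans ((congrArg g.hom hr).trans (map_zero _))
      exact (smul_eq_zero.mp h).resolve_left (nonZeroDivisors.ne_zero r.2)))
  left_inv f := by
    ext x
    rfl
  right_inv g := by
    ext x
    rfl

noncomputable instance : Reflective (flatModules R).ι where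
  L := Adjunction.leftAdjointOfEquiv (torsionFreeQuotientHomEquiv R) (fun _ _ _ _ _ => rfl)
  adj := Adjunction.adjunctionOfEquivLeft (torsionFreeQuotientHomEquiv R) (fun _ _ _ _ _ => rfl)

instance : HasColimits (FlatMod R) := hasColimits_of_reflective (flatModules R).ι

end FlatModules

/-! ### Descent of coalgebra structures along jointly epic families. -/

section JointlyEpi

open Coalgebra

variable {R : Type u} [CommRing R] [IsDomain R] [IsPrincipalIdealRing R] {J : Type*}
  {X : J → Type u} [∀ j, AddCommGroup (X j)] [∀ j, Module R (X j)]
  {L : Type u} [AddCommGroup L] [Module R L]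

/-- A family of linear maps that is jointly epic in the category of flat modules. -/
def JointlyEpi (l : ∀ j, X j →ₗ[R] L) : Prop :=
  ∀ (N : Type u) [AddCommGroup N] [Module R N] [Module.Flat R N] (f g : L →ₗ[R] N),
    (∀ j, f ∘ₗ l j = g ∘ₗ l j) → f = g

/-- Test against `(K ⊗ L) ⧸ V`: being a `K`-space, it is torsion-free and hence flat over `R`.
Surjectivity is obtained only after tensoring with `K`. -/
lemma JointlyEpi.iSup_range_eq_top {l : ∀ j, X j →ₗ[R] L} (hl : JointlyEpi l) (K : Type u)
    [Field K] [Algebra R K] [IsFractionRing R K] :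
    ⨆ j, LinearMap.range ((l j).baseChange K) = ⊤ := by
  set V := ⨆ j, LinearMap.range ((l j).baseChange K) with hV
  have := isTorsionFree_of_module_fractionRing (R := R) K ((K ⊗[R] L) ⧸ V)
  have h := hl _ (V.mkQ.restrictScalars R ∘ₗ TensorProduct.mk R K L 1) 0 fun j => by
    ext x
    refine (Submodule.Quotient.mk_eq_zero V).mpr ?_
    exact Submodule.mem_iSup_of_mem j ⟨1 ⊗ₜ x, by simp⟩
  rw [eq_top_iff, ← Submodule.baseChange_top, Submodule.baseChange_eq_span, Submodule.span_le]
  rintro _ ⟨x, -, rfl⟩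
  exact (Submodule.Quotient.mk_eq_zero V).mp (LinearMap.congr_fun h x)

variable [∀ j, Coalgebra R (X j)] [Module.Flat R L] {l : ∀ j, X j →ₗ[R] L} (hl : JointlyEpi l)
  {Δ : L →ₗ[R] L ⊗[R] L} {ε : L →ₗ[R] R} (hΔ : ∀ j, Δ ∘ₗ l j = TensorProduct.map (l j) (l j) ∘ₗ comul)
  (hε : ∀ j, ε ∘ₗ l j = counit)

/-- Coalgebra structures descend along jointly epic families. -/
@[reducible]
def JointlyEpi.coalgebra : Coalgebra R L where
  comul := Δ
  counit := ε
  coassoc := hl _ _ _ fun j => by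
    have h1 : Δ.rTensor L ∘ₗ TensorProduct.map (l j) (l j) =
        TensorProduct.map (TensorProduct.map (l j) (l j)) (l j) ∘ₗ comul.rTensor (X j) := by
      rw [LinearMap.rTensor_comp_map, hΔ, LinearMap.map_comp_rTensor]
    have h2 : Δ.lTensor L ∘ₗ TensorProduct.map (l j) (l j) =
        TensorProduct.map (l j) (TensorProduct.map (l j) (l j)) ∘ₗ comul.lTensor (X j) := by
      rw [LinearMap.lTensor_comp_map, hΔ, LinearMap.map_comp_lTensor]
    have h3 : (TensorProduct.assoc R L L L).toLinearMap ∘ₗ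
        TensorProduct.map (TensorProduct.map (l j) (l j)) (l j) =
        TensorProduct.map (l j) (TensorProduct.map (l j) (l j)) ∘ₗ
          (TensorProduct.assoc R _ _ _).toLinearMap := by
      ext; simp
    simp only [LinearMap.comp_assoc]
    rw [hΔ, ← LinearMap.comp_assoc _ _ (Δ.rTensor L), h1, LinearMap.comp_assoc,
      ← LinearMap.comp_assoc _ _ (TensorProduct.assoc R L L L).toLinearMap, h3,
      LinearMap.comp_assoc, coassoc, ← LinearMap.comp_assoc, ← h2, LinearMap.comp_assoc]
  rTensor_counit_comp_comul := hl _ _ _ fun j => by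
    rw [LinearMap.comp_assoc, hΔ, ← LinearMap.comp_assoc, LinearMap.rTensor_comp_map, hε,
      ← LinearMap.lTensor_comp_rTensor, LinearMap.comp_assoc, rTensor_counit_comp_comul]
    ext; simp
  lTensor_counit_comp_comul := hl _ _ _ fun j => by
    rw [LinearMap.comp_assoc, hΔ, ← LinearMap.comp_assoc, LinearMap.lTensor_comp_map, hε,
      ← LinearMap.rTensor_comp_lTensor, LinearMap.comp_assoc, lTensor_counit_comp_comul]
    ext; simp

lemma JointlyEpi.isCocomm [∀ j, IsCocomm R (X j)] :
    let _ := hl.coalgebra hΔ hε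
    IsCocomm R L := by
  let _ := hl.coalgebra hΔ hε
  refine ⟨hl (L ⊗[R] L) _ _ fun j => ?_⟩
  change ((TensorProduct.comm R L L).toLinearMap ∘ₗ Δ) ∘ₗ l j = Δ ∘ₗ l j
  have h : (TensorProduct.comm R L L).toLinearMap ∘ₗ TensorProduct.map (l j) (l j) =
      TensorProduct.map (l j) (l j) ∘ₗ (TensorProduct.comm R _ _).toLinearMap := by
    ext; simp
  rw [LinearMap.comp_assoc, hΔ, ← LinearMap.comp_assoc, h, LinearMap.comp_assoc,
    IsCocomm.comm_comp_comul]

end JointlyEpi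

/-! ### The forgetful functor creates colimits. -/

section Colimits

open Coalgebra Limits

variable {R : Type u} [CommRing R]

namespace FlatPointedCoalg

instance (X : FlatPointedCoalg R) : IsCocomm R X.obj := X.property.1

instance (X : FlatPointedCoalg R) : Module.Flat R X.obj := X.property.2.1

lemma isPointed (X : FlatPointedCoalg R) : IsPointedCoalgebra R X.obj := X.property.2.2

/-- The coalgebra map underlying a morphism. -/
abbrev toCoalgHom {X Y : FlatPointedCoalg R} (f : X ⟶ Y) : X.obj →ₗc[R] Y.obj :=
  f.hom.toCoalgHom

/-- A coalgebra map, as a morphism. -/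
abbrev homMk {X Y : FlatPointedCoalg R} (f : X.obj →ₗc[R] Y.obj) : X ⟶ Y :=
  ObjectProperty.homMk (CoalgCat.ofHom f)

lemma hom_ext {X Y : FlatPointedCoalg R} {f g : X ⟶ Y}
    (h : ∀ x : X.obj, toCoalgHom f x = toCoalgHom g x) : f = g :=
  ObjectProperty.hom_ext _ (CoalgCat.hom_ext _ _ (CoalgHom.ext h))

end FlatPointedCoalg

open FlatPointedCoalg

/-- A bijective morphism is an isomorphism. -/
lemma FlatPointedCoalg.isIso_of_bijective {X Y : FlatPointedCoalg R} (f : X ⟶ Y)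
    (h : Function.Bijective (toCoalgHom f)) : IsIso f := by
  have : IsIso ((forget (CoalgCat.{u} R)).map f.hom) := (isIso_iff_bijective _).mpr h
  have : IsIso f.hom := isIso_of_reflects_iso f.hom (forget (CoalgCat.{u} R))
  exact (ObjectProperty.isIso_hom_iff f).mp this

instance : (forgetToFlatMod R).ReflectsIsomorphisms where
  reflects {X Y} f hf := by
    have : IsIso ((forgetToFlatMod R).map f).hom := (ObjectProperty.isIso_hom_iff _).mpr hf
    exact isIso_of_bijective f (ConcreteCategory.bijective_of_isIso ((forgetToFlatMod R).map f).hom)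

instance : (forgetToFlatMod R).Faithful where
  map_injective {X Y _ _} h := FlatPointedCoalg.hom_ext fun x =>
    congrArg (fun k : (forgetToFlatMod R).obj X ⟶ (forgetToFlatMod R).obj Y => k.hom.hom x) h

variable [IsDomain R] [IsPrincipalIdealRing R]
  {J : Type u} [Category.{u} J] (F : J ⥤ FlatPointedCoalg R) {c : Cocone (F ⋙ forgetToFlatMod R)}

/-- The linear maps underlying a cocone in flat modules. -/
abbrev coconeMap (c : Cocone (F ⋙ forgetToFlatMod R)) (j : J) : (F.obj j).obj →ₗ[R] c.pt.obj :=
  (c.ι.app j).hom.hom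

lemma coconeMap_comp (c : Cocone (F ⋙ forgetToFlatMod R)) {i j : J} (a : i ⟶ j) :
    coconeMap F c j ∘ₗ (toCoalgHom (F.map a)).toLinearMap = coconeMap F c i :=
  congrArg (fun k => k.hom.hom) (c.w a)

variable {F} in
/-- The cocone in flat modules attached to a compatible family of linear maps. -/
def flatCocone {N : Type u} [AddCommGroup N] [Module R N] [Module.Flat R N]
    (g : ∀ j, (F.obj j).obj →ₗ[R] N)
    (hg : ∀ {i j : J} (a : i ⟶ j), g j ∘ₗ (toCoalgHom (F.map a)).toLinearMap = g i) :
    Cocone (F ⋙ forgetToFlatMod R) where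
  pt := FlatMod.of R N
  ι :=
    { app := fun j => ObjectProperty.homMk (ModuleCat.ofHom (g j))
      naturality := fun i j a => by
        apply ObjectProperty.hom_ext
        apply ModuleCat.hom_ext
        exact hg a }

lemma jointlyEpi_coconeMap (hc : IsColimit c) : JointlyEpi (coconeMap F c) := by
  intro N _ _ _ f g h
  have : (ObjectProperty.homMk (ModuleCat.ofHom f) : c.pt ⟶ FlatMod.of R N) =
      ObjectProperty.homMk (ModuleCat.ofHom g) :=
    hc.hom_ext fun j => ObjectProperty.hom_ext _ (ModuleCat.hom_ext (h j))
  exact congrArg (fun k => k.hom.hom) this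

/-- The linear map out of a colimit of flat modules. -/
noncomputable def colimitDesc (hc : IsColimit c) {N : Type u} [AddCommGroup N] [Module R N]
    [Module.Flat R N] (g : ∀ j, (F.obj j).obj →ₗ[R] N)
    (hg : ∀ {i j : J} (a : i ⟶ j), g j ∘ₗ (toCoalgHom (F.map a)).toLinearMap = g i) :
    c.pt.obj →ₗ[R] N :=
  (hc.desc (flatCocone g hg)).hom.hom

lemma colimitDesc_comp (hc : IsColimit c) {N : Type u} [AddCommGroup N] [Module R N]
    [Module.Flat R N] (g : ∀ j, (F.obj j).obj →ₗ[R] N)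
    (hg : ∀ {i j : J} (a : i ⟶ j), g j ∘ₗ (toCoalgHom (F.map a)).toLinearMap = g i) (j : J) :
    colimitDesc F hc g hg ∘ₗ coconeMap F c j = g j :=
  congrArg (fun k => k.hom.hom) (hc.fac (flatCocone g hg) j)

lemma map_coconeMap_comul (c : Cocone (F ⋙ forgetToFlatMod R)) {i j : J} (a : i ⟶ j) :
    (TensorProduct.map (coconeMap F c j) (coconeMap F c j) ∘ₗ comul) ∘ₗ
        (toCoalgHom (F.map a)).toLinearMap =
      TensorProduct.map (coconeMap F c i) (coconeMap F c i) ∘ₗ comul := by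
  rw [LinearMap.comp_assoc, ← CoalgHom.map_comp_comul, ← LinearMap.comp_assoc,
    ← TensorProduct.map_comp, coconeMap_comp]

/-- The comultiplication of the colimit. -/
noncomputable def colimitComul (hc : IsColimit c) : c.pt.obj →ₗ[R] c.pt.obj ⊗[R] c.pt.obj :=
  colimitDesc F hc (fun j => TensorProduct.map (coconeMap F c j) (coconeMap F c j) ∘ₗ comul)
    (map_coconeMap_comul F c)

/-- The counit of the colimit. -/
noncomputable def colimitCounit (hc : IsColimit c) : c.pt.obj →ₗ[R] R :=
  colimitDesc F hc (fun _ => counit) fun {_ _} a => (toCoalgHom (F.map a)).counit_comp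

lemma colimitComul_comp (hc : IsColimit c) (j : J) : colimitComul F hc ∘ₗ coconeMap F c j =
    TensorProduct.map (coconeMap F c j) (coconeMap F c j) ∘ₗ comul :=
  colimitDesc_comp F hc _ (map_coconeMap_comul F c) j

lemma colimitCounit_comp (hc : IsColimit c) (j : J) :
    colimitCounit F hc ∘ₗ coconeMap F c j = counit :=
  colimitDesc_comp F hc _ (fun {_ _} a => (toCoalgHom (F.map a)).counit_comp) j

/-- The coalgebra structure on a colimit of the underlying flat modules. -/
noncomputable def colimitObj (hc : IsColimit c) : FlatPointedCoalg R :=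
  letI := (jointlyEpi_coconeMap F hc).coalgebra (colimitComul_comp F hc) (colimitCounit_comp F hc)
  { obj := { c.pt.obj with instCoalgebra := this }
    property := by
      have hco : IsCocomm R c.pt.obj := (jointlyEpi_coconeMap F hc).isCocomm _ _
      refine ⟨hco, c.pt.property, ?_⟩
      exact isPointedCoalgebra_of_iSup_range_eq_top (FractionRing R) (C := c.pt.obj)
        (fun j => (F.obj j).isPointed)
        (fun j => { coconeMap F c j with
          counit_comp := colimitCounit_comp F hc j
          map_comp_comul := (colimitComul_comp F hc j).symm })
        ((jointlyEpi_coconeMap F hc).iSup_range_eq_top _) }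

/-- The colimit cocone of coalgebras. -/
noncomputable def colimitCoalgCocone (hc : IsColimit c) : Cocone F where
  pt := colimitObj F hc
  ι :=
    { app := fun j => FlatPointedCoalg.homMk (Y := colimitObj F hc)
        { coconeMap F c j with
          counit_comp := colimitCounit_comp F hc j
          map_comp_comul := (colimitComul_comp F hc j).symm }
      naturality := fun _ _ a => FlatPointedCoalg.hom_ext fun x =>
        LinearMap.congr_fun (coconeMap_comp F c a) x }

noncomputable def isColimitColimitCoalgCocone (hc : IsColimit c) :
    IsColimit (colimitCoalgCocone F hc) where
  desc s :=
    let d : c.pt.obj →ₗ[R] s.pt.obj := (hc.desc ((forgetToFlatMod R).mapCocone s)).hom.hom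
    have hd (j : J) : d ∘ₗ coconeMap F c j = (toCoalgHom (s.ι.app j)).toLinearMap :=
      congrArg (fun k => k.hom.hom) (hc.fac ((forgetToFlatMod R).mapCocone s) j)
    FlatPointedCoalg.homMk (X := colimitObj F hc)
      { d with
        counit_comp := jointlyEpi_coconeMap F hc R _ _ fun j => by
          refine Eq.trans ?_ (colimitCounit_comp F hc j).symm
          change counit ∘ₗ (d ∘ₗ coconeMap F c j) = _
          rw [hd]
          exact (toCoalgHom (s.ι.app j)).counit_comp
        map_comp_comul := jointlyEpi_coconeMap F hc _ _ _ fun j => by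
          change (TensorProduct.map d d ∘ₗ colimitComul F hc) ∘ₗ coconeMap F c j =
            (comul ∘ₗ d) ∘ₗ coconeMap F c j
          rw [LinearMap.comp_assoc, LinearMap.comp_assoc, hd, colimitComul_comp,
            ← LinearMap.comp_assoc, ← TensorProduct.map_comp, hd]
          exact (toCoalgHom (s.ι.app j)).map_comp_comul }
  fac s j := FlatPointedCoalg.hom_ext fun x =>
    congrArg (fun k => k.hom.hom x) (hc.fac ((forgetToFlatMod R).mapCocone s) j)
  uniq s m hm := (forgetToFlatMod R).map_injective <|
    hc.uniq ((forgetToFlatMod R).mapCocone s) ((forgetToFlatMod R).map m) fun j =>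
      congrArg (forgetToFlatMod R).map (hm j)

noncomputable instance : CreatesColimits (forgetToFlatMod R) where
  CreatesColimitsOfShape :=
    { CreatesColimit := fun {F} => createsColimitOfReflectsIso fun _ hc =>
        { liftedCocone := colimitCoalgCocone F hc
          validLift := Iso.refl _
          makesColimit := isColimitColimitCoalgCocone F hc } }

instance : HasColimits (FlatPointedCoalg R) :=
  hasColimits_of_hasColimits_createsColimits (forgetToFlatMod R)

end Colimits

/-! ### A separating set of coalgebras of finite rank. -/

section Separating

open Coalgebra Limits

variable {R : Type u} [CommRing R]

namespace PureSubcoalgebra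

variable {C : Type u} [AddCommGroup C] [Module R C] [Coalgebra R C]

/-- The inclusion of a pure subcoalgebra. -/
def subtypeHom (D : PureSubcoalgebra R C) : D.carrier →ₗc[R] C where
  toLinearMap := D.carrier.subtype
  counit_comp := rfl
  map_comp_comul := D.map_comul

instance [IsCocomm R C] (D : PureSubcoalgebra R C) : IsCocomm R D.carrier where
  comm_comp_comul := by
    have h : TensorProduct.map D.carrier.subtype D.carrier.subtype ∘ₗ
        (TensorProduct.comm R _ _).toLinearMap = (TensorProduct.comm R C C).toLinearMap ∘ₗ
          TensorProduct.map D.carrier.subtype D.carrier.subtype := by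
      ext; simp
    refine LinearMap.cancel_left D.map_injective |>.mp ?_
    change _ ∘ₗ _ ∘ₗ D.comul = _ ∘ₗ D.comul
    rw [← LinearMap.comp_assoc, h, LinearMap.comp_assoc, D.map_comul, ← LinearMap.comp_assoc,
      IsCocomm.comm_comp_comul]

end PureSubcoalgebra

variable [IsDomain R] [IsPrincipalIdealRing R]

instance (M : Type u) [AddCommGroup M] [Module R M] [Module.Flat R M] (N : Submodule R M) :
    Module.Flat R N :=
  have : Module.IsTorsionFree R M := Module.Flat.isTorsionFree
  inferInstance

namespace FlatPointedCoalg

/-- A pure subcoalgebra, as an object. -/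
noncomputable def ofPure (X : FlatPointedCoalg R) (D : PureSubcoalgebra R X.obj) :
    FlatPointedCoalg R where
  obj := CoalgCat.of R D.carrier
  property :=
    ⟨inferInstanceAs (IsCocomm R D.carrier), inferInstanceAs (Module.Flat R D.carrier),
      X.isPointed.of_injective D.subtypeHom D.carrier.injective_subtype⟩

variable (X : FlatPointedCoalg R) {N : Type u} [AddCommGroup N] [Module R N] (e : X.obj ≃ₗ[R] N)

/-- Regarding an equivalence as a one-member jointly epic family makes transport of structure an
instance of descent. -/
lemma jointlyEpi_linearEquiv : JointlyEpi fun _ : Unit => e.toLinearMap := fun _ _ _ _ f g h => by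
  ext x
  simpa using LinearMap.congr_fun (h ()) (e.symm x)

/-- Transport of a coalgebra structure along a linear equivalence. -/
@[reducible]
noncomputable def transportCoalgebra : Coalgebra R N :=
  have : Module.Flat R N := .of_linearEquiv e.symm
  (jointlyEpi_linearEquiv X e).coalgebra
    (Δ := TensorProduct.map e.toLinearMap e.toLinearMap ∘ₗ comul ∘ₗ e.symm.toLinearMap)
    (ε := counit ∘ₗ e.symm.toLinearMap) (fun _ => by ext; simp) (fun _ => by ext; simp)

/-- The transported coalgebra maps to the original one. -/
noncomputable def transportHom :
    letI := transportCoalgebra X e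
    N →ₗc[R] X.obj :=
  letI := transportCoalgebra X e
  { e.symm.toLinearMap with
    counit_comp := rfl
    map_comp_comul := by
      change TensorProduct.map e.symm.toLinearMap e.symm.toLinearMap ∘ₗ
        TensorProduct.map e.toLinearMap e.toLinearMap ∘ₗ comul ∘ₗ e.symm.toLinearMap = _
      rw [← LinearMap.comp_assoc, ← TensorProduct.map_comp]
      simp }

lemma transport_property :
    flatPointedCocommutative R
      { ModuleCat.of R N with instCoalgebra := transportCoalgebra X e } := by
  have hflat : Module.Flat R N := .of_linearEquiv e.symm
  have hco := (jointlyEpi_linearEquiv X e).isCocomm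
    (Δ := TensorProduct.map e.toLinearMap e.toLinearMap ∘ₗ comul ∘ₗ e.symm.toLinearMap)
    (ε := counit ∘ₗ e.symm.toLinearMap) (fun _ => by ext; simp) (fun _ => by ext; simp)
  let _ := transportCoalgebra X e
  have hco : IsCocomm R N := hco
  exact ⟨hco, hflat, X.isPointed.of_injective (transportHom X e) e.symm.injective⟩

end FlatPointedCoalg

open FlatPointedCoalg

/-- Flat pointed cocommutative coalgebra structures on submodules of the modules `Kⁿ`. -/
structure SmallCoalgebra (R : Type u) [CommRing R] where
  rank : ℕ
  carrier : Submodule R (Fin rank → FractionRing R)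
  inst : Coalgebra R carrier
  property : flatPointedCocommutative R { ModuleCat.of R carrier with instCoalgebra := inst }

/-- The object attached to a coalgebra structure on a submodule of `Kⁿ`. -/
def SmallCoalgebra.toObj (A : SmallCoalgebra R) : FlatPointedCoalg R := ⟨_, A.property⟩

lemma exists_injective_pi {K V : Type*} [Field K] [AddCommGroup V] [Module K V]
    (U : Submodule K V) [Module.Finite K U] :
    ∃ (n : ℕ) (j : U →ₗ[K] (Fin n → K)), Function.Injective j :=
  ⟨_, (Module.finBasis K U).equivFun.toLinearMap, (Module.finBasis K U).equivFun.injective⟩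

/-- Every element of a flat cocommutative coalgebra lies in a pure subcoalgebra of finite rank. -/
lemma exists_pureSubcoalgebra_injective_pi {C : Type u} [AddCommGroup C] [Module R C]
    [Coalgebra R C] [IsCocomm R C] [Module.Flat R C] (x : C) :
    ∃ (D : PureSubcoalgebra R C) (_ : x ∈ D.carrier) (n : ℕ)
      (j : D.carrier →ₗ[R] (Fin n → FractionRing R)), Function.Injective j := by
  obtain ⟨V, hx, hV, hfin⟩ := exists_finite_isActInvariant ((1 : FractionRing R) ⊗ₜ[R] x)
  obtain ⟨n, j, hj⟩ := exists_injective_pi V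
  refine ⟨hV.pureSubcoalgebra, hV.mem_pureSubcoalgebra.mpr hx, n, j.restrictScalars R ∘ₗ
      (TensorProduct.mk R (FractionRing R) C 1 ∘ₗ
        hV.pureSubcoalgebra.carrier.subtype).codRestrict (V.restrictScalars R)
        fun d => hV.mem_pureSubcoalgebra.mp d.2, hj.comp fun a b h => ?_⟩
  exact Subtype.ext (tmul_one_injective _ (congrArg Subtype.val h))

/-- A finite-rank pure subcoalgebra through `x` is copied onto a submodule of `Kⁿ`; such structures
form a type in `Type u`, which supplies the smallness needed for the adjoint functor theorem. -/
lemma exists_smallCoalgebra_hom (X : FlatPointedCoalg R) (x : X.obj) :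
    ∃ (A : SmallCoalgebra R) (h : A.toObj ⟶ X), x ∈ Set.range (toCoalgHom h) := by
  obtain ⟨D, hx, n, j, hj⟩ := exists_pureSubcoalgebra_injective_pi (R := R) x
  let e : (X.ofPure D).obj ≃ₗ[R] LinearMap.range j := LinearEquiv.ofInjective j hj
  let _ := transportCoalgebra (X.ofPure D) e
  refine ⟨⟨n, LinearMap.range j, transportCoalgebra (X.ofPure D) e, transport_property _ e⟩,
    ObjectProperty.homMk (CoalgCat.ofHom (D.subtypeHom.comp (transportHom (X.ofPure D) e))),
    e ⟨x, hx⟩, ?_⟩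
  exact congrArg Subtype.val (e.symm_apply_apply (⟨x, hx⟩ : D.carrier))

lemma isSeparating_smallCoalgebra :
    (ObjectProperty.ofObj (SmallCoalgebra.toObj (R := R))).IsSeparating := by
  intro X Y f g h
  refine FlatPointedCoalg.hom_ext fun x => ?_
  obtain ⟨A, k, a, rfl⟩ := exists_smallCoalgebra_hom X x
  exact congrArg (fun m => toCoalgHom m a) (h _ ⟨A⟩ k)

end Separating

/-! ### Well-copoweredness and the adjoint functor theorem. -/

section WellCopowered

open Coalgebra Limits FlatPointedCoalg

variable {R : Type u} [CommRing R] [IsDomain R] [IsPrincipalIdealRing R]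
  {X Y Z : FlatPointedCoalg R}

/-- The forgetful functor preserves colimits, hence epimorphisms. -/
lemma FlatPointedCoalg.jointlyEpi_of_epi (f : X ⟶ Y) [Epi f] :
    JointlyEpi fun _ : Unit => (toCoalgHom f).toLinearMap := by
  intro N _ _ _ a b h
  have : Epi ((forgetToFlatMod R).map f) := inferInstance
  have h' : (ObjectProperty.homMk (ModuleCat.ofHom a) :
      (forgetToFlatMod R).obj Y ⟶ FlatMod.of R N) = ObjectProperty.homMk (ModuleCat.ofHom b) := by
    rw [← cancel_epi ((forgetToFlatMod R).map f)]
    exact ObjectProperty.hom_ext _ (ModuleCat.hom_ext (h ()))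
  exact congrArg (fun k => k.hom.hom) h'

lemma FlatPointedCoalg.exists_smul_mem_range_of_epi (f : X ⟶ Y) [Epi f] (y : Y.obj) :
    ∃ (r : R) (x : X.obj), r ≠ 0 ∧ r • y = toCoalgHom f x := by
  let K := FractionRing R
  have h := (jointlyEpi_of_epi f).iSup_range_eq_top K
  rw [iSup_const] at h
  obtain ⟨z, hz⟩ := LinearMap.range_eq_top.mp h (1 ⊗ₜ y)
  obtain ⟨r, x, hr, hx⟩ := exists_smul_eq_one_tmul z
  refine ⟨r, x, hr, tmul_one_injective (R := R) K ?_⟩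
  rw [TensorProduct.mk_apply, TensorProduct.mk_apply, TensorProduct.tmul_smul, ← hz]
  have := congrArg ((toCoalgHom f).toLinearMap.baseChange K) hx
  rw [LinearMap.baseChange_tmul] at this
  refine Eq.trans ?_ this
  exact (((toCoalgHom f).toLinearMap.baseChange K).restrictScalars R).map_smul r z |>.symm

/-- The invariant that determines a quotient of `X`. -/
def quotientInvariant (f : X ⟶ Y) : Set (R × X.obj) :=
  {p | ∃ y : Y.obj, p.1 • y = toCoalgHom f p.2}

lemma exists_factor_of_quotientInvariant_eq (f : X ⟶ Y) (g : X ⟶ Z) [Epi f]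
    (h : quotientInvariant f = quotientInvariant g) : ∃ k : Y ⟶ Z, f ≫ k = g := by
  have hY : Module.IsTorsionFree R Y.obj := Module.Flat.isTorsionFree
  have hZ : Module.IsTorsionFree R Z.obj := Module.Flat.isTorsionFree
  let F : X.obj →ₗ[R] Y.obj × Z.obj := (toCoalgHom f).toLinearMap.prod (toCoalgHom g).toLinearMap
  -- The saturation of the image of `(f, g)`, which will be the graph of the factorization `k`.
  let Γ : Submodule R (Y.obj × Z.obj) :=
    { carrier := {p | ∃ (r : R) (x : X.obj), r ≠ 0 ∧ r • p = F x}
      zero_mem' := ⟨1, 0, one_ne_zero, by simp⟩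
      add_mem' := by
        rintro p q ⟨r, x, hr, hp⟩ ⟨s, y, hs, hq⟩
        refine ⟨r * s, s • x + r • y, mul_ne_zero hr hs, ?_⟩
        rw [map_add, map_smul, map_smul, ← hp, ← hq, smul_smul, smul_smul, smul_add, mul_comm s r]
      smul_mem' := by
        rintro a p ⟨r, x, hr, hp⟩
        exact ⟨r, a • x, hr, by rw [map_smul, ← hp, smul_comm]⟩ }
  -- Pairs `(0, x)` in the invariant record the kernel; pairs `(r, x)` with `r ≠ 0` record which
  -- images become divisible by `r`.
  have hker (x : X.obj) (hx : toCoalgHom f x = 0) : toCoalgHom g x = 0 := by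
    have : ((0 : R), x) ∈ quotientInvariant g := by
      rw [← h]
      exact ⟨0, by simp [hx]⟩
    obtain ⟨z, hz⟩ := this
    rw [← hz, zero_smul]
  let π : Γ →ₗ[R] Y.obj := LinearMap.fst R _ _ ∘ₗ Γ.subtype
  have hπ : Function.Bijective π := by
    constructor
    · refine (injective_iff_map_eq_zero π).mpr ?_
      rintro ⟨⟨y, z⟩, r, x, hr, hp⟩ (rfl : y = 0)
      obtain ⟨h1, h2⟩ := Prod.ext_iff.mp hp
      have h1 : r • (0 : Y.obj) = toCoalgHom f x := h1
      have h2 : r • z = toCoalgHom g x := h2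
      rw [hker x (by rw [← h1, smul_zero])] at h2
      have : z = 0 := (smul_eq_zero.mp h2).resolve_left hr
      subst this
      rfl
    · intro y
      obtain ⟨r, x, hr, hx⟩ := exists_smul_mem_range_of_epi f y
      have : (r, x) ∈ quotientInvariant g := h ▸ ⟨y, hx⟩
      obtain ⟨z, hz⟩ := this
      exact ⟨⟨(y, z), r, x, hr, Prod.ext hx hz⟩, rfl⟩
  let k : Y.obj →ₗ[R] Z.obj :=
    LinearMap.snd R _ _ ∘ₗ Γ.subtype ∘ₗ (LinearEquiv.ofBijective π hπ).symm.toLinearMap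
  have hk : k ∘ₗ (toCoalgHom f).toLinearMap = (toCoalgHom g).toLinearMap := by
    ext x
    have hmem : F x ∈ Γ := ⟨1, x, one_ne_zero, one_smul _ _⟩
    have : (LinearEquiv.ofBijective π hπ).symm (toCoalgHom f x) = ⟨F x, hmem⟩ := by
      rw [LinearEquiv.symm_apply_eq]
      rfl
    exact congrArg (fun p => p.1.2) this
  have hepi := jointlyEpi_of_epi f
  refine ⟨FlatPointedCoalg.homMk { k with
    counit_comp := hepi _ _ _ fun _ => ?_
    map_comp_comul := hepi _ _ _ fun _ => ?_ }, FlatPointedCoalg.hom_ext (LinearMap.congr_fun hk)⟩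
  · change counit ∘ₗ (k ∘ₗ (toCoalgHom f).toLinearMap) = _
    rw [hk, CoalgHom.counit_comp, CoalgHom.counit_comp]
  · change TensorProduct.map k k ∘ₗ (comul ∘ₗ (toCoalgHom f).toLinearMap) =
      comul ∘ₗ (k ∘ₗ (toCoalgHom f).toLinearMap)
    rw [hk, ← CoalgHom.map_comp_comul, ← CoalgHom.map_comp_comul, ← LinearMap.comp_assoc,
      ← TensorProduct.map_comp, hk]

/-- A quotient of `X` is determined by a subset of `R × X`, and these subsets form a type in `Type
u`. -/
instance : WellPowered.{u} (FlatPointedCoalg R)ᵒᵖ where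
  subobject_small X := by
    let S : Subobject X → Set (R × X.unop.obj) := fun P => quotientInvariant P.arrow.unop
    have hle (P Q : Subobject X) (h : S P = S Q) : P ≤ Q := by
      obtain ⟨k, hk⟩ := exists_factor_of_quotientInvariant_eq Q.arrow.unop P.arrow.unop h.symm
      exact Subobject.le_of_comm k.op (Quiver.Hom.unop_inj hk)
    exact small_of_injective (f := S) fun P Q h => le_antisymm (hle P Q h) (hle Q P h.symm)

/-- The special adjoint functor theorem for flat pointed cocommutative coalgebras. -/
lemma isLeftAdjoint_of_preservesColimits {D : Type*} [Category.{u} D]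
    (F : FlatPointedCoalg R ⥤ D) [PreservesColimits F] : F.IsLeftAdjoint :=
  isLeftAdjoint_of_preservesColimits_of_isSeparating isSeparating_smallCoalgebra F

instance : (forgetToFlatMod R).IsLeftAdjoint := isLeftAdjoint_of_preservesColimits _

end WellCopowered

/-! ### Equalizers of cosplit pairs and Beck's theorem. -/

section Comonadic

open Coalgebra Limits FlatPointedCoalg

variable {R : Type u} [CommRing R] [IsDomain R] [IsPrincipalIdealRing R]
  {A B : FlatPointedCoalg R} (f g : A ⟶ B)

/-- The linear map whose kernel is the equalizer. -/
abbrev diffMap : A.obj →ₗ[R] B.obj := (toCoalgHom f).toLinearMap - (toCoalgHom g).toLinearMap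

lemma mem_ker_diffMap {x : A.obj} :
    x ∈ LinearMap.ker (diffMap f g) ↔ toCoalgHom f x = toCoalgHom g x := by
  rw [LinearMap.mem_ker, LinearMap.sub_apply, sub_eq_zero]
  rfl

variable [(forgetToFlatMod R).IsCosplitPair f g]

/-- The equalizer of a pair that is split on underlying modules. -/
noncomputable def equalizerOfCosplit : PureSubcoalgebra R A.obj where
  carrier := LinearMap.ker (diffMap f g)
  isPure :=
    have : Module.IsTorsionFree R B.obj := Module.Flat.isTorsionFree
    isPureSubmodule_ker _
  comul_mem x hx := by
    have S := HasSplitEqualizer.isSplitEqualizer ((forgetToFlatMod R).map f)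
      ((forgetToFlatMod R).map g)
    let i : _ →ₗ[R] A.obj := (HasSplitEqualizer.equalizerι ((forgetToFlatMod R).map f)
      ((forgetToFlatMod R).map g)).hom.hom
    let r : A.obj →ₗ[R] _ := S.leftRetraction.hom.hom
    let t : B.obj →ₗ[R] A.obj := S.rightRetraction.hom.hom
    have hi : (toCoalgHom f).toLinearMap ∘ₗ i = (toCoalgHom g).toLinearMap ∘ₗ i :=
      congrArg (fun k => k.hom.hom) S.condition
    have htg : t ∘ₗ (toCoalgHom g).toLinearMap = LinearMap.id :=
      congrArg (fun k => k.hom.hom) S.bottom_rightRetraction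
    have htf : t ∘ₗ (toCoalgHom f).toLinearMap = i ∘ₗ r :=
      congrArg (fun k => k.hom.hom) S.top_rightRetraction
    -- For `x` in the kernel, `Δx = (t ⊗ t)(g ⊗ g)Δx = (t ⊗ t)Δ(g x) = (t ⊗ t)Δ(f x) = (t ∘ f ⊗ t ∘
    -- f)Δx`, and `t ∘ f = i ∘ r` takes values in the kernel.
    let p : A.obj →ₗ[R] LinearMap.ker (diffMap f g) := (i ∘ₗ r).codRestrict _ fun y =>
      (mem_ker_diffMap f g).mpr (LinearMap.congr_fun hi (r y))
    refine ⟨TensorProduct.map p p (comul x), ?_⟩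
    have h1 : TensorProduct.map (LinearMap.ker (diffMap f g)).subtype
        (LinearMap.ker (diffMap f g)).subtype ∘ₗ TensorProduct.map p p =
        TensorProduct.map t t ∘ₗ TensorProduct.map (toCoalgHom f).toLinearMap
          (toCoalgHom f).toLinearMap := by
      rw [← TensorProduct.map_comp, ← TensorProduct.map_comp, htf]
      rfl
    have h2 : TensorProduct.map t t ∘ₗ TensorProduct.map (toCoalgHom g).toLinearMap
        (toCoalgHom g).toLinearMap = LinearMap.id := by
      rw [← TensorProduct.map_comp, htg, TensorProduct.map_id]
    have hf : TensorProduct.map (toCoalgHom f).toLinearMap (toCoalgHom f).toLinearMap (comul x) =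
        comul (toCoalgHom f x) := CoalgHomClass.map_comp_comul_apply (toCoalgHom f) x
    have hg : TensorProduct.map (toCoalgHom g).toLinearMap (toCoalgHom g).toLinearMap (comul x) =
        comul (toCoalgHom g x) := CoalgHomClass.map_comp_comul_apply (toCoalgHom g) x
    refine (LinearMap.congr_fun h1 (comul x)).trans ?_
    rw [LinearMap.comp_apply, hf, (mem_ker_diffMap f g).mp hx, ← hg]
    exact LinearMap.congr_fun h2 (comul x)

/-- The inclusion of the equalizer. -/
noncomputable def equalizerOfCosplitι : A.ofPure (equalizerOfCosplit f g) ⟶ A :=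
  ObjectProperty.homMk (CoalgCat.ofHom (equalizerOfCosplit f g).subtypeHom)

lemma equalizerOfCosplit_condition : equalizerOfCosplitι f g ≫ f = equalizerOfCosplitι f g ≫ g :=
  FlatPointedCoalg.hom_ext fun x => (mem_ker_diffMap f g).mp x.2

/-- A coalgebra map into a pure subcoalgebra. -/
def PureSubcoalgebra.codRestrict {C D : Type u} [AddCommGroup C] [Module R C] [Coalgebra R C]
    [AddCommGroup D] [Module R D] [Coalgebra R D] (S : PureSubcoalgebra R D) (h : C →ₗc[R] D)
    (hS : ∀ c, h c ∈ S.carrier) : C →ₗc[R] S.carrier where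
  toLinearMap := h.toLinearMap.codRestrict S.carrier hS
  counit_comp := h.counit_comp
  map_comp_comul := by
    refine LinearMap.cancel_left S.map_injective |>.mp ?_
    rw [← LinearMap.comp_assoc, ← LinearMap.comp_assoc, ← TensorProduct.map_comp]
    exact h.map_comp_comul.trans
      (congrArg (· ∘ₗ h.toLinearMap.codRestrict S.carrier hS) S.map_comul).symm

/-- The universal property of the equalizer, for coalgebras. -/
noncomputable def isLimitEqualizerOfCosplit :
    IsLimit (Fork.ofι _ (equalizerOfCosplit_condition f g)) :=
  Fork.IsLimit.mk' _ fun s =>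
    ⟨ObjectProperty.homMk (CoalgCat.ofHom ((equalizerOfCosplit f g).codRestrict (toCoalgHom s.ι)
        fun c => (mem_ker_diffMap f g).mpr (congrArg (fun k => toCoalgHom k c) s.condition))),
      FlatPointedCoalg.hom_ext fun _ => rfl, fun hm => FlatPointedCoalg.hom_ext fun c =>
        Subtype.ext (congrArg (fun k => toCoalgHom k c) hm)⟩

/-- The universal property of the equalizer, for flat modules. -/
noncomputable def isLimitMapEqualizerOfCosplit :
    IsLimit ((forgetToFlatMod R).mapCone (Fork.ofι _ (equalizerOfCosplit_condition f g))) :=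
  (isLimitMapConeForkEquiv (forgetToFlatMod R) (equalizerOfCosplit_condition f g)).symm <|
    Fork.IsLimit.mk' _ fun s =>
      ⟨ObjectProperty.homMk (ModuleCat.ofHom (s.ι.hom.hom.codRestrict
          (equalizerOfCosplit f g).carrier fun c =>
            (mem_ker_diffMap f g).mpr (congrArg (fun k => k.hom.hom c) s.condition))),
        rfl, fun hm => ObjectProperty.hom_ext _ (ModuleCat.hom_ext (LinearMap.ext fun c =>
          Subtype.ext (congrArg (fun k => k.hom.hom c) hm)))⟩

instance : Comonad.HasEqualizerOfIsCosplitPair (forgetToFlatMod R) where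
  out f g _ := ⟨⟨_, isLimitEqualizerOfCosplit f g⟩⟩

instance : Comonad.PreservesLimitOfIsCosplitPair (forgetToFlatMod R) where
  out f g _ := preservesLimit_of_preserves_limit_cone (isLimitEqualizerOfCosplit f g)
    (isLimitMapEqualizerOfCosplit f g)

/-- The forgetful functor to flat modules is comonadic. -/
@[reducible]
noncomputable def comonadicForgetToFlatMod : ComonadicLeftAdjoint (forgetToFlatMod R) :=
  Comonad.comonadicOfHasPreservesFSplitEqualizersOfReflectsIsomorphisms
    (Adjunction.ofIsLeftAdjoint (forgetToFlatMod R))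

end Comonadic

/-! ### The tensor product as categorical product. -/

section Monoidal

open Coalgebra Limits FlatPointedCoalg

variable {R : Type u} [CommRing R] [IsDomain R] [IsPrincipalIdealRing R]

instance : (flatPointedCocommutative R).IsMonoidal where
  prop_unit := ⟨inferInstanceAs (IsCocomm R R), inferInstanceAs (Module.Flat R R),
    isPointedCoalgebra_self⟩
  prop_tensor X Y hX hY := by
    have := hX.1
    have := hX.2.1
    have := hY.1
    have := hY.2.1
    exact ⟨inferInstanceAs (IsCocomm R (X ⊗[R] Y)), inferInstanceAs (Module.Flat R (X ⊗[R] Y)),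
      hX.2.2.tensor hY.2.2⟩

/-- The ground ring is terminal. -/
noncomputable def isTerminalUnit : IsTerminal (𝟙_ (FlatPointedCoalg R)) :=
  IsTerminal.ofUniqueHom (fun X => ObjectProperty.homMk (CoalgCat.ofHom (counitCoalgHom R X.obj)))
    fun _ m => FlatPointedCoalg.hom_ext fun x => CoalgHomClass.counit_comp_apply (toCoalgHom m) x

/-- The first projection of the tensor product. -/
noncomputable def tensorFst (X Y : FlatPointedCoalg R) : X ⊗ Y ⟶ X :=
  X ◁ isTerminalUnit.from Y ≫ (ρ_ X).hom

/-- The second projection of the tensor product. -/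
noncomputable def tensorSnd (X Y : FlatPointedCoalg R) : X ⊗ Y ⟶ Y :=
  isTerminalUnit.from X ▷ Y ≫ (λ_ Y).hom

lemma tensorFst_eq (X Y : FlatPointedCoalg R) : (toCoalgHom (tensorFst X Y)).toLinearMap =
    (TensorProduct.rid R X.obj).toLinearMap ∘ₗ counit.lTensor X.obj := by
  apply TensorProduct.ext'
  intro x y
  rfl

lemma tensorSnd_eq (X Y : FlatPointedCoalg R) : (toCoalgHom (tensorSnd X Y)).toLinearMap =
    (TensorProduct.lid R Y.obj).toLinearMap ∘ₗ counit.rTensor Y.obj := by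
  apply TensorProduct.ext'
  intro x y
  rfl

/-- The pairing of two morphisms. -/
noncomputable def tensorLift {T X Y : FlatPointedCoalg R} (f : T ⟶ X) (g : T ⟶ Y) : T ⟶ X ⊗ Y :=
  ObjectProperty.homMk (CoalgCat.ofHom
    ((Coalgebra.TensorProduct.map (toCoalgHom f) (toCoalgHom g)).comp (comulCoalgHom R T.obj)))

/-- This yields uniqueness of the pairing: a morphism into `X ⊗ Y` is recovered from its two
components. -/
lemma map_tensorFst_tensorSnd_comul (X Y : FlatPointedCoalg R) :
    TensorProduct.map (toCoalgHom (tensorFst X Y)).toLinearMap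
      (toCoalgHom (tensorSnd X Y)).toLinearMap ∘ₗ
        comul (R := R) (A := X.obj ⊗[R] Y.obj) = LinearMap.id := by
  apply TensorProduct.ext'
  intro x y
  rw [tensorFst_eq, tensorSnd_eq, LinearMap.comp_apply, TensorProduct.comul_tmul]
  have h (a : X.obj ⊗[R] X.obj) (b : Y.obj ⊗[R] Y.obj) :
      TensorProduct.map ((TensorProduct.rid R X.obj).toLinearMap ∘ₗ counit.lTensor X.obj)
        ((TensorProduct.lid R Y.obj).toLinearMap ∘ₗ counit.rTensor Y.obj)
        (TensorProduct.AlgebraTensorModule.tensorTensorTensorComm R R R R _ _ _ _ (a ⊗ₜ b)) =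
      TensorProduct.rid R X.obj (counit.lTensor X.obj a) ⊗ₜ
        TensorProduct.lid R Y.obj (counit.rTensor Y.obj b) := by
    induction a with
    | zero => simp
    | add a₁ a₂ h₁ h₂ => simp only [TensorProduct.add_tmul, map_add, h₁, h₂]
    | tmul a₁ a₂ =>
      induction b with
      | zero => simp
      | add b₁ b₂ h₁ h₂ => simp only [TensorProduct.tmul_add, map_add, h₁, h₂]
      | tmul b₁ b₂ =>
        simp [TensorProduct.smul_tmul, TensorProduct.tmul_smul]
        exact smul_comm _ _ _
  refine (h _ _).trans ?_
  rw [lTensor_counit_comul, rTensor_counit_comul]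
  simp

lemma tensorFst_comp_map {T X Y : FlatPointedCoalg R} (f : T ⟶ X) (g : T ⟶ Y) :
    (toCoalgHom (tensorFst X Y)).toLinearMap ∘ₗ TensorProduct.map (toCoalgHom f).toLinearMap
        (toCoalgHom g).toLinearMap =
      (toCoalgHom f).toLinearMap ∘ₗ (TensorProduct.rid R T.obj).toLinearMap ∘ₗ
        counit.lTensor T.obj := by
  rw [tensorFst_eq, LinearMap.comp_assoc, LinearMap.lTensor_comp_map, CoalgHom.counit_comp]
  apply TensorProduct.ext'
  intro x y
  simp

lemma tensorSnd_comp_map {T X Y : FlatPointedCoalg R} (f : T ⟶ X) (g : T ⟶ Y) :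
    (toCoalgHom (tensorSnd X Y)).toLinearMap ∘ₗ TensorProduct.map (toCoalgHom f).toLinearMap
        (toCoalgHom g).toLinearMap =
      (toCoalgHom g).toLinearMap ∘ₗ (TensorProduct.lid R T.obj).toLinearMap ∘ₗ
        counit.rTensor T.obj := by
  rw [tensorSnd_eq, LinearMap.comp_assoc, LinearMap.rTensor_comp_map, CoalgHom.counit_comp]
  apply TensorProduct.ext'
  intro x y
  simp

/-- The tensor product is the product. -/
noncomputable def isLimitTensor (X Y : FlatPointedCoalg R) :
    IsLimit (BinaryFan.mk (tensorFst X Y) (tensorSnd X Y)) :=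
  BinaryFan.IsLimit.mk _ (fun f g => tensorLift f g)
    (fun {T} f g => FlatPointedCoalg.hom_ext fun t => by
      refine (LinearMap.congr_fun (tensorFst_comp_map f g) (comul t)).trans ?_
      rw [LinearMap.comp_apply, LinearMap.comp_apply, lTensor_counit_comul]
      simp
      rfl)
    (fun {T} f g => FlatPointedCoalg.hom_ext fun t => by
      refine (LinearMap.congr_fun (tensorSnd_comp_map f g) (comul t)).trans ?_
      rw [LinearMap.comp_apply, LinearMap.comp_apply, rTensor_counit_comul]
      simp
      rfl)
    (fun {T} f g m hf hg => FlatPointedCoalg.hom_ext fun t => by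
      subst hf hg
      refine (LinearMap.congr_fun (map_tensorFst_tensorSnd_comul X Y) (toCoalgHom m t)).symm.trans ?_
      rw [LinearMap.comp_apply]
      refine (congrArg _ (CoalgHomClass.map_comp_comul_apply (toCoalgHom m) t).symm).trans ?_
      rw [← LinearMap.comp_apply]
      erw [← TensorProduct.map_comp]
      rfl)

/-- Flat pointed cocommutative coalgebras form a cartesian monoidal category. -/
@[reducible]
noncomputable def cartesianMonoidalCategory : CartesianMonoidalCategory (FlatPointedCoalg R) where
  toMonoidalCategory := ObjectProperty.fullMonoidalSubcategory (flatPointedCocommutative R)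
  isTerminalTensorUnit := isTerminalUnit
  fst := tensorFst
  snd := tensorSnd
  fst_def _ _ := rfl
  snd_def _ _ := rfl
  tensorProductIsBinaryProduct := isLimitTensor

end Monoidal

/-! ### Cartesian closedness. -/

section Closed

open Limits FlatPointedCoalg

variable {R : Type u} [CommRing R] [IsDomain R] [IsPrincipalIdealRing R]

/-- Linear maps into a torsion-free module form a torsion-free, hence flat, module, so the
tensor-hom adjunction stays within flat modules. -/
instance (M N : Type u) [AddCommGroup M] [Module R M] [AddCommGroup N] [Module R N]
    [Module.Flat R N] : Module.Flat R (M →ₗ[R] N) :=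
  have : Module.IsTorsionFree R N := Module.Flat.isTorsionFree
  have : Module.IsTorsionFree R (M →ₗ[R] N) :=
    Function.Injective.moduleIsTorsionFree (fun f => (f : M → N)) DFunLike.coe_injective
      fun _ _ => rfl
  inferInstance

variable (M : Type u) [AddCommGroup M] [Module R M] [Module.Flat R M]

/-- Tensoring with a flat module, on flat modules. -/
noncomputable def flatTensorLeft : FlatMod R ⥤ FlatMod R where
  obj N := FlatMod.of R (M ⊗[R] N.obj)
  map f := FlatMod.ofHom (f.hom.hom.lTensor M)
  map_id _ := ObjectProperty.hom_ext _ (ModuleCat.hom_ext (LinearMap.lTensor_id _ _))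
  map_comp _ _ := ObjectProperty.hom_ext _ (ModuleCat.hom_ext (LinearMap.lTensor_comp _ _ _))

/-- The tensor-hom adjunction for flat modules. -/
noncomputable def flatTensorHomEquiv (N P : FlatMod R) :
    ((flatTensorLeft M).obj N ⟶ P) ≃ (N ⟶ FlatMod.of R (M →ₗ[R] P.obj)) where
  toFun f := ObjectProperty.homMk (ModuleCat.ofHom (TensorProduct.curry f.hom.hom).flip)
  invFun g := ObjectProperty.homMk (ModuleCat.ofHom (TensorProduct.lift g.hom.hom.flip))
  left_inv f := by
    apply ObjectProperty.hom_ext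
    apply ModuleCat.hom_ext
    apply TensorProduct.ext'
    intro x y
    rfl
  right_inv g := by
    apply ObjectProperty.hom_ext
    apply ModuleCat.hom_ext
    rfl

instance : (flatTensorLeft (R := R) M).IsLeftAdjoint :=
  (Adjunction.adjunctionOfEquivRight (flatTensorHomEquiv M) (fun _ _ _ _ _ => rfl)).isLeftAdjoint

/-- The forgetful functor commutes with tensor products. -/
noncomputable def tensorLeftForgetIso (X : FlatPointedCoalg R) :
    forgetToFlatMod R ⋙ flatTensorLeft X.obj ≅ tensorLeft X ⋙ forgetToFlatMod R :=
  NatIso.ofComponents (fun _ => Iso.refl _) fun _ => rfl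

/-- On underlying modules `X ⊗ -` is a left adjoint, and the forgetful functor preserves and
reflects colimits. -/
instance (X : FlatPointedCoalg R) : PreservesColimits (tensorLeft X) := by
  have : PreservesColimits (tensorLeft X ⋙ forgetToFlatMod R) :=
    preservesColimits_of_natIso (tensorLeftForgetIso X)
  exact preservesColimits_of_reflects_of_preserves (tensorLeft X) (forgetToFlatMod R)

/-- Flat pointed cocommutative coalgebras form a closed monoidal category. -/
@[reducible]
noncomputable def monoidalClosed : MonoidalClosed (FlatPointedCoalg R) where
  closed X :=
    have := isLeftAdjoint_of_preservesColimits (tensorLeft X)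
    { rightAdj := (tensorLeft X).rightAdjoint
      adj := Adjunction.ofIsLeftAdjoint (tensorLeft X) }

end Closed

theorem mainTheorem8 (R : Type u) [CommRing R] [IsDomain R] [IsPrincipalIdealRing R] :
    ((forgetToFlatMod R).IsLeftAdjoint ∧ Nonempty (ComonadicLeftAdjoint (forgetToFlatMod R))) ∧
    (∃ _ : (flatPointedCocommutative R).IsMonoidal,
      (∃ cart : CartesianMonoidalCategory (FlatPointedCoalg R),
        cart.toMonoidalCategory =
          ObjectProperty.fullMonoidalSubcategory (flatPointedCocommutative R)) ∧
      Nonempty (MonoidalClosed (FlatPointedCoalg R))) :=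
  ⟨⟨inferInstance, ⟨comonadicForgetToFlatMod⟩⟩, inferInstance, ⟨cartesianMonoidalCategory, rfl⟩,
    ⟨monoidalClosed⟩⟩
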